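/- Let $\Sigma$ be a finite alphabet. A (nondeterministic) input-driven double-head pushdown automaton $M$ over $\Sigma$ has a finite state set $Q$, an initial state $q_0\in Q$, a set $F\subseteq Q$ of accepting states, a finite set $\Gamma$ of pushdown symbols, an empty-pushdown symbol $\bot\notin\Gamma$, and two input heads that start at the left and at the right end of the input and move towards each other. In each step exactly one head is moved and reads one symbol, namely the first (left head) or the last (right head) symbol of the unread part of the input; there are no steps that read nothing. Each head has a signature, that is, a partition $\Sigma=\Sigma_D\cup\Sigma_R\cup\Sigma_N$, and the class of the symbol read by the moved head determines the action on the pushdown store: for a symbol in $\Sigma_D$ one symbol of $\Gamma$ is pushed, for a symbol in $\Sigma_R$ the topmost symbol is popped (an empty store stays empty), and for a symbol in $\Sigma_N$ the store is unchanged. The set of possible successor states (together with the symbol pushed, in the case of $\Sigma_D$) depends on the current state, the moved head, the symbol read, and the topmost pushdown symbol ($\bot$ if the store is empty). The automaton accepts the words $w$ for which some computation from $q_0$ with unread input $w$ and empty pushdown store reads the whole input and ends in a state of $F$, with arbitrary pushdown content. It is deterministic if in every configuration (state, unread input, pushdown content) there is at most one possible action. It is of single-signature type if both heads have the same signature, and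 of double type if the two heads may have different signatures. Let $\mathcal{F}$ be the family of languages over finite alphabets accepted by deterministic double input-driven double-head pushdown automata, and let $\mathcal{G}$ be the family of languages over finite alphabets accepted by nondeterministic single-signature input-driven double-head pushdown automata. Then $\mathcal{F}$ and $\mathcal{G}$ are incomparable: $\mathcal{F}\not\subseteq\mathcal{G}$ and $\mathcal{G}\not\subseteq\mathcal{F}$. More precisely, over every finite alphabet that contains the (pairwise distinct) symbols in question, \[ L_{ta}=\{\,a^nb^na^n \mid n\ge 1\,\}\in\mathcal{F}\setminus\mathcal{G} \] and \[ L_{dta}=\{\,a^nb^nc^n\$_l\,c^ib^ja^k \mid i,j,k,n\ge 0\,\}\cup\{\,a^ib^jc^k\$_r\,c^nb^na^n \mid i,j,k,n\ge 0\,\}\in\mathcal{G}\setminus\mathcal{F}. \] -/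

import Mathlib

/-- The two input heads: the left head moves to the right, the right head moves to the left. -/
inductive Head where
  | left
  | right

/-- What an input symbol does to the pushdown store: `push` (the symbols of `Σ_D`),
`pop` (`Σ_R`), or `keep`, a mere change of state (`Σ_N`). -/
inductive StackOp where
  | push
  | pop
  | keep

/-- A (nondeterministic) input-driven double-head pushdown automaton over the input alphabet `α`,
where each head has its own signature.

A signature is a partition of `α` into `Σ_D`, `Σ_R`, `Σ_N`, given by the function that sends a
symbol to its class. In every step exactly one head reads exactly one symbol, so a transition
depends on the state, the head that is moved, the symbol it reads, and the top of the pushdown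
store, where `none` is the empty pushdown symbol `⊥`. A transition that is undefined is given by
the empty set. The values of `deltaD` at symbols outside of `Σ_D` of the head that is moved are
never used, and likewise for `deltaR` and `deltaN`. -/
structure DoubleHeadPDA (α : Type) where
  State : Type
  Stack : Type
  finite_state : Finite State
  finite_stack : Finite Stack
  signature : Head → α → StackOp
  start : State
  accept : Set State
  deltaD : State → Head → α → Option Stack → Set (State × Stack)
  deltaR : State → Head → α → Option Stack → Set State
  deltaN : State → Head → α → Option Stack → Set State

/-- The unread input before head `h` reads the symbol `a`, if `w` is what is left unread after. -/
def Head.attach {α : Type} : Head → α → List α → List α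
  | Head.left, a, w => a :: w
  | Head.right, a, w => w ++ [a]

namespace DoubleHeadPDA

variable {α : Type}

/-- A configuration: the state, the unread part of the input, and the content of the
pushdown store with its top at the front of the list. -/
abbrev Config (M : DoubleHeadPDA α) : Type := M.State × List α × List M.Stack

/-- `M.Step h c c'`: moving head `h` leads from `c` to `c'` in one step. A `pop` on the empty
pushdown store leaves it empty. -/
inductive Step (M : DoubleHeadPDA α) (h : Head) : M.Config → M.Config → Prop
  | push {q q' : M.State} {a : α} {v w : List α} {s : List M.Stack} {z : M.Stack}
      (hv : v = h.attach a w) (ha : M.signature h a = StackOp.push)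
      (ht : (q', z) ∈ M.deltaD q h a s.head?) : Step M h (q, v, s) (q', w, z :: s)
  | pop {q q' : M.State} {a : α} {v w : List α} {s : List M.Stack}
      (hv : v = h.attach a w) (ha : M.signature h a = StackOp.pop)
      (ht : q' ∈ M.deltaR q h a s.head?) : Step M h (q, v, s) (q', w, s.tail)
  | keep {q q' : M.State} {a : α} {v w : List α} {s : List M.Stack}
      (hv : v = h.attach a w) (ha : M.signature h a = StackOp.keep)
      (ht : q' ∈ M.deltaN q h a s.head?) : Step M h (q, v, s) (q', w, s)

/-- `M.Reaches c c'`: some finite (possibly empty) sequence of steps leads from `c` to `c'`. -/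
def Reaches (M : DoubleHeadPDA α) : M.Config → M.Config → Prop :=
  Relation.ReflTransGen fun c c' => ∃ h : Head, M.Step h c c'

/-- The accepted language: the words that some computation reads entirely, ending in an
accepting state, with any content of the pushdown store. -/
def language (M : DoubleHeadPDA α) : Language α :=
  {w | ∃ (q : M.State) (s : List M.Stack), q ∈ M.accept ∧ M.Reaches (M.start, w, []) (q, [], s)}

/-- There is at most one choice of action (which head to move, and with which result) in any
configuration. -/
def Deterministic (M : DoubleHeadPDA α) : Prop :=
  ∀ (c c₁ c₂ : M.Config) (h₁ h₂ : Head), M.Step h₁ c c₁ → M.Step h₂ c c₂ → h₁ = h₂ ∧ c₁ = c₂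

/-- Both heads obey the same signature. -/
def SingleSignature (M : DoubleHeadPDA α) : Prop :=
  M.signature Head.left = M.signature Head.right

end DoubleHeadPDA

/-- The languages over `α` accepted by deterministic double input-driven double-head pushdown
automata (each head has its own signature). -/
def DetDoubleFamily (α : Type) : Set (Language α) :=
  {L | ∃ M : DoubleHeadPDA α, M.Deterministic ∧ M.language = L}

/-- The languages over `α` accepted by nondeterministic input-driven double-head pushdown
automata (a single signature for both heads). -/
def NondetSingleFamily (α : Type) : Set (Language α) :=
  {L | ∃ M : DoubleHeadPDA α, M.SingleSignature ∧ M.language = L}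

/-- `{a^n b^n a^n | n ≥ 1}`. -/
def langTa {α : Type} (a b : α) : Language α :=
  {w | ∃ n : ℕ, 1 ≤ n ∧ w = List.replicate n a ++ List.replicate n b ++ List.replicate n a}

/-- `{a^n b^n c^n $ₗ c^i b^j a^k | i, j, k, n ≥ 0} ∪ {a^i b^j c^k $ᵣ c^n b^n a^n | i, j, k, n ≥ 0}`,
where `l` is the left marker `$ₗ` and `r` is the right marker `$ᵣ`. -/
def langDta {α : Type} (a b c l r : α) : Language α :=
  {w | (∃ i j k n : ℕ, w =
      List.replicate n a ++ List.replicate n b ++ List.replicate n c ++ [l] ++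
        List.replicate i c ++ List.replicate j b ++ List.replicate k a) ∨
    (∃ i j k n : ℕ, w =
      List.replicate i a ++ List.replicate j b ++ List.replicate k c ++ [r] ++
        List.replicate n c ++ List.replicate n b ++ List.replicate n a)}

/-! Both non-membership proofs cut and paste runs and conclude by the pigeonhole principle. A run is
recorded as a sequence of labels (head, symbol), and the input that it consumes depends only on the
two projections of this sequence, so the input of a pasted run can be read off (`word`). A segment
that stays above some part of the store sees only the top `Z` of that part. It can therefore be
replaced by a segment of another run with the same end states and the same `Z`.

For `langDta`, put `u = a^n b^n c^n`. By determinism either the left head reads all of `u l` on `u l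
u^R`, or the right head reads all of `u r` on `u r u^R` (`exists_reads_marker`). Cutting at the
lowest store level during the block `b` yields one segment touching only the blocks `a` and `b`, and
one touching only `b`, `c` and what follows (`exists_blockRun`). Exchanging either of them between
two exponents with equal finite data leaves one outer block intact, and the language forces the
exponents to agree (`BlockRun.eq`).

For `langTa`, a single signature makes the store height count letters independently of the heads.
Some segment then reads equally many `a` and `b`, while the language demands twice as many `a`
(`exists_nestedRun`, `NestedRun.le`).

Membership is by explicit automata. With two signatures the left head pushes `a` while the right
head ignores it, so `taPDA` compares the outer blocks by alternation and then pops with `b`. In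
`langDta` the letter `c` is the one to be ignored, so one signature suffices, but the automaton must
guess which marker the word contains. -/

/-- The symbol read by head `h` in a labelled step, if it is the head that moves. -/
def Head.pick {α : Type} : Head → Head × α → Option α
  | Head.left, (Head.left, x) => some x
  | Head.right, (Head.right, x) => some x
  | _, _ => none

/-- The symbols that head `h` reads along a sequence of labels, in the order of reading. -/
def Head.proj {α : Type} (h : Head) (σ : List (Head × α)) : List α :=
  σ.filterMap h.pick

/-- The other head. -/
def Head.opp : Head → Head
  | Head.left => Head.right
  | Head.right => Head.left

/-! ### Runs as sequences of labels -/

namespace DoubleHeadPDA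

variable {α : Type}

/-- The input word that is consumed entirely by a sequence of labels. -/
def word (σ : List (Head × α)) : List α :=
  Head.left.proj σ ++ (Head.right.proj σ).reverse

theorem proj_cons_same (h : Head) (x : α) (σ : List (Head × α)) :
    h.proj ((h, x) :: σ) = x :: h.proj σ := by
  cases h <;> exact List.filterMap_cons_some rfl

theorem proj_cons_opp (h : Head) (x : α) (σ : List (Head × α)) :
    h.opp.proj ((h, x) :: σ) = h.opp.proj σ := by
  cases h <;> exact List.filterMap_cons_none rfl

theorem word_cons (h : Head) (x : α) (σ : List (Head × α)) :
    word ((h, x) :: σ) = h.attach x (word σ) := by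
  cases h
  · have h1 := proj_cons_opp Head.left x σ
    have h2 := proj_cons_same Head.left x σ
    simp only [Head.opp] at h1
    simp [word, Head.attach, h1, h2]
  · have h1 := proj_cons_opp Head.right x σ
    have h2 := proj_cons_same Head.right x σ
    simp only [Head.opp] at h1
    simp [word, Head.attach, h1, h2]

theorem proj_append (h : Head) (σ τ : List (Head × α)) :
    h.proj (σ ++ τ) = h.proj σ ++ h.proj τ := by
  simp [Head.proj]

theorem exists_append_of_proj_eq {h : Head} {σ : List (Head × α)} {u v : List α}
    (H : h.proj σ = u ++ v) : ∃ σ₁ σ₂, σ = σ₁ ++ σ₂ ∧ h.proj σ₁ = u ∧ h.proj σ₂ = v := by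
  obtain ⟨σ₁, σ₂, h1, h2, h3⟩ := List.filterMap_eq_append_iff.1 H
  exact ⟨σ₁, σ₂, h1, h2, h3⟩

/-- A step on labels, for a pushdown store whose content lies above a fixed part with top `Z`;
the fixed part may not be popped, unless it is empty. -/
inductive Move (M : DoubleHeadPDA α) (Z : Option M.Stack) (h : Head) (x : α) :
    M.State → List M.Stack → M.State → List M.Stack → Prop
  | push {q q' : M.State} {s : List M.Stack} {z : M.Stack}
      (ha : M.signature h x = StackOp.push)
      (ht : (q', z) ∈ M.deltaD q h x (s.head?.or Z)) : Move M Z h x q s q' (z :: s)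
  | pop {q q' : M.State} {s : List M.Stack}
      (ha : M.signature h x = StackOp.pop) (hs : s ≠ [] ∨ Z = none)
      (ht : q' ∈ M.deltaR q h x (s.head?.or Z)) : Move M Z h x q s q' s.tail
  | keep {q q' : M.State} {s : List M.Stack}
      (ha : M.signature h x = StackOp.keep)
      (ht : q' ∈ M.deltaN q h x (s.head?.or Z)) : Move M Z h x q s q' s

/-- Sequences of moves above a fixed part of the pushdown store with top `Z`. -/
inductive RunOver (M : DoubleHeadPDA α) (Z : Option M.Stack) :
    M.State → List M.Stack → List (Head × α) → M.State → List M.Stack → Prop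
  | nil (q : M.State) (s : List M.Stack) : RunOver M Z q s [] q s
  | cons {q q' q'' : M.State} {s s' s'' : List M.Stack} {h : Head} {x : α} {σ : List (Head × α)}
      (hm : M.Move Z h x q s q' s') (hr : RunOver M Z q' s' σ q'' s'') :
      RunOver M Z q s ((h, x) :: σ) q'' s''

variable {M : DoubleHeadPDA α}

theorem Step.exists_move {h : Head} {c c' : M.Config} (H : M.Step h c c') :
    ∃ x, c.2.1 = h.attach x c'.2.1 ∧ M.Move none h x c.1 c.2.2 c'.1 c'.2.2 := by
  cases H with
  | push hv ha ht => exact ⟨_, hv, .push ha (by simpa using ht)⟩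
  | pop hv ha ht => exact ⟨_, hv, .pop ha (Or.inr rfl) (by simpa using ht)⟩
  | keep hv ha ht => exact ⟨_, hv, .keep ha (by simpa using ht)⟩

theorem Move.step {h : Head} {x : α} {q q' : M.State} {s s' : List M.Stack}
    (H : M.Move none h x q s q' s') (w : List α) :
    M.Step h (q, h.attach x w, s) (q', w, s') := by
  cases H with
  | push ha ht => exact .push rfl ha (by simpa using ht)
  | pop ha hs ht => exact .pop rfl ha (by simpa using ht)
  | keep ha ht => exact .keep rfl ha (by simpa using ht)

theorem RunOver.reaches {q q' : M.State} {s s' : List M.Stack} {σ : List (Head × α)}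
    (H : M.RunOver none q s σ q' s') : M.Reaches (q, word σ, s) (q', [], s') := by
  induction H with
  | nil q s => exact Relation.ReflTransGen.refl
  | cons hm hr ih =>
    rw [word_cons]
    exact Relation.ReflTransGen.head ⟨_, hm.step _⟩ ih

theorem exists_runOver_of_reaches {c c' : M.Config} (H : M.Reaches c c') (hc : c'.2.1 = []) :
    ∃ σ, word σ = c.2.1 ∧ M.RunOver none c.1 c.2.2 σ c'.1 c'.2.2 := by
  induction H using Relation.ReflTransGen.head_induction_on with
  | refl => exact ⟨[], by simp [word, Head.proj, hc], .nil _ _⟩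
  | head h1 _ ih =>
    obtain ⟨σ, h2, h3⟩ := ih
    obtain ⟨h, h1⟩ := h1
    obtain ⟨x, hx, hm⟩ := h1.exists_move
    exact ⟨(h, x) :: σ, by rw [word_cons, h2, hx], .cons hm h3⟩

theorem mem_language_iff {w : List α} : w ∈ M.language ↔
    ∃ σ q s, q ∈ M.accept ∧ M.RunOver none M.start [] σ q s ∧ word σ = w := by
  constructor
  · rintro ⟨q, s, hq, H⟩
    obtain ⟨σ, h1, h2⟩ := exists_runOver_of_reaches H rfl
    exact ⟨σ, q, s, hq, h2, h1⟩
  · rintro ⟨σ, q, s, hq, H, rfl⟩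
    exact ⟨q, s, hq, H.reaches⟩

/-! ### Cutting, lifting and pasting runs -/

theorem RunOver.append {Z : Option M.Stack} {q₁ q₂ q₃ : M.State} {s₁ s₂ s₃ : List M.Stack}
    {σ τ : List (Head × α)} (H : M.RunOver Z q₁ s₁ σ q₂ s₂) (H' : M.RunOver Z q₂ s₂ τ q₃ s₃) :
    M.RunOver Z q₁ s₁ (σ ++ τ) q₃ s₃ := by
  induction H with
  | nil q s => exact H'
  | cons hm hr ih => exact .cons hm (ih H')

theorem RunOver.exists_of_append {Z : Option M.Stack} {q₁ q₃ : M.State} {s₁ s₃ : List M.Stack}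
    {σ τ : List (Head × α)} (H : M.RunOver Z q₁ s₁ (σ ++ τ) q₃ s₃) :
    ∃ q₂ s₂, M.RunOver Z q₁ s₁ σ q₂ s₂ ∧ M.RunOver Z q₂ s₂ τ q₃ s₃ := by
  induction σ generalizing q₁ s₁ with
  | nil => exact ⟨q₁, s₁, .nil _ _, H⟩
  | cons p σ ih =>
    cases H with
    | cons hm hr =>
      obtain ⟨q₂, s₂, h1, h2⟩ := ih hr
      exact ⟨q₂, s₂, .cons hm h1, h2⟩

/-- A move above a fixed part inspects only the top of that part, and pops the empty upper store
only if nothing lies below. Hence the whole of `b` can be put underneath. -/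
theorem Move.lift {Z : Option M.Stack} {h : Head} {x : α} {q q' : M.State} {s s' : List M.Stack}
    (b : List M.Stack) (H : M.Move (b.head?.or Z) h x q s q' s') :
    M.Move Z h x q (s ++ b) q' (s' ++ b) := by
  have e : (s ++ b).head?.or Z = s.head?.or (b.head?.or Z) := by
    rw [List.head?_append, Option.or_assoc]
  cases H with
  | push ha ht => exact .push ha (by rwa [e])
  | pop ha hs ht =>
    cases s with
    | nil =>
      have hb : b = [] ∧ Z = none := by simpa using hs
      obtain ⟨rfl, rfl⟩ := hb
      exact .pop (s := []) ha (Or.inr rfl) (by simpa using ht)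
    | cons y s => exact .pop (s := y :: s ++ b) ha (Or.inl (by simp)) (by rwa [e])
  | keep ha ht => exact .keep ha (by rwa [e])

theorem RunOver.lift {Z : Option M.Stack} {q q' : M.State} {s s' : List M.Stack}
    {σ : List (Head × α)} (b : List M.Stack) (H : M.RunOver (b.head?.or Z) q s σ q' s') :
    M.RunOver Z q (s ++ b) σ q' (s' ++ b) := by
  induction H with
  | nil q s => exact .nil _ _
  | cons hm hr ih => exact .cons (hm.lift b) ih

theorem RunOver.lift_none {q q' : M.State} {s s' : List M.Stack}
    {σ : List (Head × α)} (b : List M.Stack) (H : M.RunOver b.head? q s σ q' s') :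
    M.RunOver none q (s ++ b) σ q' (s' ++ b) :=
  RunOver.lift b (by simpa using H)

theorem or_head?_append (s b : List M.Stack) :
    (s ++ b).head?.or none = s.head?.or b.head? := by
  rw [Option.or_none, List.head?_append]

/-- The last part of a run that stays above a given part of the final store. -/
theorem RunOver.exists_last_above {q q' : M.State} {s b : List M.Stack} {σ : List (Head × α)}
    (H : M.RunOver none q [] σ q' (s ++ b)) : ∃ σ₁ σ₂ p, σ = σ₁ ++ σ₂ ∧
      M.RunOver none q [] σ₁ p b ∧ M.RunOver b.head? p [] σ₂ q' s := by
  induction σ using List.reverseRecOn generalizing q' s with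
  | nil =>
    generalize e : s ++ b = t at H
    cases H
    obtain ⟨rfl, rfl⟩ := List.append_eq_nil_iff.1 e
    exact ⟨[], [], q, rfl, .nil _ _, .nil _ _⟩
  | append_singleton σ x ih =>
    by_cases hs : s = []
    · subst hs
      exact ⟨σ ++ [x], [], q', by simp, H, .nil _ _⟩
    obtain ⟨p, t, h1, h2⟩ := H.exists_of_append
    have key : ∃ u, t = u ++ b ∧ M.RunOver b.head? p u [x] q' s := by
      generalize e : s ++ b = v at h2
      cases h2 with
      | cons hm hr =>
        cases hr
        cases hm with
        | push ha ht =>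
          cases s with
          | nil => exact absurd rfl hs
          | cons y s =>
            obtain ⟨rfl, rfl⟩ := List.cons_eq_cons.1 e
            refine ⟨s, rfl, .cons (.push ha ?_) (.nil _ _)⟩
            rw [← or_head?_append]
            exact ht
        | pop ha _ ht =>
          cases t with
          | nil => simp [hs] at e
          | cons y t =>
            simp only [List.tail_cons] at e
            subst e
            exact ⟨y :: s, rfl,
              .cons (.pop (s := y :: s) ha (Or.inl (by simp)) (by simpa using ht)) (.nil _ _)⟩
        | keep ha ht =>
          subst e
          exact ⟨s, rfl, .cons (.keep ha (by rwa [or_head?_append] at ht)) (.nil _ _)⟩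
    obtain ⟨u, rfl, h3⟩ := key
    obtain ⟨σ₁, σ₂, p', rfl, h4, h5⟩ := ih h1
    exact ⟨σ₁, σ₂ ++ [x], p', by simp, h4, h5.append h3⟩

/-- A run splits where the height of its store is minimal. -/
theorem RunOver.exists_min {q q' : M.State} {s s' : List M.Stack} {σ : List (Head × α)}
    (H : M.RunOver none q s σ q' s') : ∃ σ₁ σ₂ p s₁ s₂ b, σ = σ₁ ++ σ₂ ∧ s = s₁ ++ b ∧
      s' = s₂ ++ b ∧ M.RunOver b.head? q s₁ σ₁ p [] ∧ M.RunOver b.head? p [] σ₂ q' s₂ := by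
  induction H with
  | nil q s => exact ⟨[], [], q, [], [], s, rfl, rfl, rfl, .nil _ _, .nil _ _⟩
  | @cons q q₁ q'' s t s'' h x σ hm hr ih =>
    obtain ⟨σ₁, σ₂, p, s₁, s₂, b, rfl, rfl, rfl, h1, h2⟩ := ih
    generalize e : s₁ ++ b = t at hm
    cases hm with
    | @push _ _ z ha ht =>
      cases s₁ with
      | nil =>
        simp only [List.nil_append] at e
        subst e
        -- The rest of the run never removes the symbol `z` just pushed, so the minimum is now at
        -- the very beginning, with `z` belonging to the upper part.
        refine ⟨[], (h, x) :: (σ₁ ++ σ₂), q, [], s₂ ++ [z], s, rfl, rfl, by simp, .nil _ _, ?_⟩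
        refine .cons (.push (z := z) ha (by simpa using ht)) ?_
        exact RunOver.lift (s := []) [z] (by simpa using h1.append h2)
      | cons y s₁ =>
        obtain ⟨rfl, rfl⟩ := List.cons_eq_cons.1 e
        refine ⟨(h, x) :: σ₁, σ₂, p, s₁, s₂, b, rfl, rfl, rfl, .cons (.push ha ?_) h1, h2⟩
        rw [← or_head?_append]
        exact ht
    | pop ha _ ht =>
      cases s with
      | nil =>
        obtain ⟨rfl, rfl⟩ := List.append_eq_nil_iff.1 e
        exact ⟨(h, x) :: σ₁, σ₂, p, [], s₂, [], rfl, rfl, rfl,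
          .cons (.pop (s := []) ha (Or.inr rfl) (by simpa using ht)) h1, h2⟩
      | cons y s =>
        simp only [List.tail_cons] at e
        subst e
        exact ⟨(h, x) :: σ₁, σ₂, p, y :: s₁, s₂, b, rfl, rfl, rfl,
          .cons (.pop (s := y :: s₁) ha (Or.inl (by simp)) (by simpa using ht)) h1, h2⟩
    | keep ha ht =>
      subst e
      exact ⟨(h, x) :: σ₁, σ₂, p, s₁, s₂, b, rfl, rfl, rfl,
        .cons (.keep ha (by rwa [or_head?_append] at ht)) h1, h2⟩

/-- A run either stays strictly above a given part of its initial store, or returns to it. -/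
theorem RunOver.above_or_return {q q' : M.State} {s b s' : List M.Stack} {σ : List (Head × α)}
    (H : M.RunOver none q (s ++ b) σ q' s') :
    (∃ s₂, M.RunOver b.head? q s σ q' s₂) ∨
    ∃ σ₁ σ₂ p, σ = σ₁ ++ σ₂ ∧ M.RunOver b.head? q s σ₁ p [] ∧ M.RunOver none p b σ₂ q' s' := by
  induction σ generalizing q s with
  | nil => cases H; exact Or.inl ⟨s, .nil _ _⟩
  | cons y σ ih =>
    by_cases hs : s = []
    · subst hs
      exact Or.inr ⟨[], y :: σ, q, rfl, .nil _ _, H⟩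
    cases H with
    | @cons _ q₁ _ _ t _ h x _ hm hr =>
      have key : ∃ u, t = u ++ b ∧ M.Move b.head? h x q s q₁ u := by
        cases hm with
        | push ha ht => exact ⟨_, rfl, .push ha (by rwa [or_head?_append] at ht)⟩
        | pop ha _ ht =>
          exact ⟨s.tail, List.tail_append_of_ne_nil hs,
            .pop ha (Or.inl hs) (by rwa [or_head?_append] at ht)⟩
        | keep ha ht => exact ⟨_, rfl, .keep ha (by rwa [or_head?_append] at ht)⟩
      obtain ⟨u, rfl, hm'⟩ := key
      rcases ih hr with ⟨s₂, h1⟩ | ⟨σ₁, σ₂, p, rfl, h1, h2⟩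
      · exact Or.inl ⟨s₂, .cons hm' h1⟩
      · exact Or.inr ⟨_ :: σ₁, σ₂, p, rfl, .cons hm' h1, h2⟩

theorem count_word [BEq α] (x : α) (σ : List (Head × α)) :
    (word σ).count x = (σ.map Prod.snd).count x := by
  induction σ with
  | nil => simp [word, Head.proj]
  | cons p σ ih =>
    obtain ⟨h, y⟩ := p
    rw [word_cons, List.map_cons, List.count_cons, ← ih]
    cases h <;> simp [Head.attach, List.count_cons, List.count_append]

theorem mem_word {x : α} {σ : List (Head × α)} : x ∈ word σ ↔ x ∈ σ.map Prod.snd := by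
  induction σ with
  | nil => simp [word, Head.proj]
  | cons p σ ih =>
    obtain ⟨h, y⟩ := p
    rw [word_cons, List.map_cons, List.mem_cons, ← ih]
    cases h <;> simp [Head.attach, or_comm]

end DoubleHeadPDA

/-! ### `langDta` is not accepted deterministically -/

/-- The marker that head `h` looks for: `l` for the left head and `r` for the right head. -/
def Head.marker {α : Type} (l r : α) : Head → α
  | Head.left => l
  | Head.right => r

theorem reverse_mem_langDta {α : Type} {a b c l r : α} {w : List α}
    (H : w ∈ langDta a b c l r) : w.reverse ∈ langDta a b c r l := by
  rcases H with ⟨i, j, k, n, rfl⟩ | ⟨i, j, k, n, rfl⟩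
  · exact Or.inr ⟨k, j, i, n, by simp⟩
  · exact Or.inl ⟨k, j, i, n, by simp⟩

/-- The symbol `l` occurs only in words of the first kind, where it closes the three equal blocks.
What follows it plays no role. -/
theorem eq_of_append_mem_langDta {α : Type} {a b c l r : α} (hd : [a, b, c, l, r].Nodup)
    {i j k : ℕ} {e : List α}
    (H : List.replicate i a ++ List.replicate j b ++ List.replicate k c ++ l :: e ∈
      langDta a b c l r) : i = j ∧ j = k := by
  classical
  simp only [List.nodup_cons, List.mem_cons, List.not_mem_nil, or_false, not_or] at hd
  obtain ⟨⟨hab, hac, hal, har⟩, ⟨hbc, hbl, hbr⟩, ⟨hcl, hcr⟩, hlr, -⟩ := hd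
  rcases H with ⟨i', j', k', n, H⟩ | ⟨i', j', k', n, H⟩
  · simp only [List.append_assoc, List.cons_append, List.nil_append] at H
    simp only [← List.append_assoc] at H
    have hl : ∀ i j k, l ∉ List.replicate i a ++ List.replicate j b ++ List.replicate k c := by
      simp [List.mem_replicate, Ne.symm hal, Ne.symm hbl, Ne.symm hcl]
    have h1 := (List.append_cons_inj_of_notMem (hl n n n) (by
      simp [List.mem_replicate, Ne.symm hal, Ne.symm hbl, Ne.symm hcl])).1 H.symm
    have h2 := congrArg (List.count a) h1.1
    have h3 := congrArg (List.count b) h1.1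
    have h4 := congrArg (List.count c) h1.1
    simp [List.count_replicate, hab, hac, hbc, Ne.symm hab, Ne.symm hac, Ne.symm hbc]
      at h2 h3 h4
    omega
  · have h1 : l ∈ List.replicate i a ++ List.replicate j b ++ List.replicate k c ++ l :: e := by
      simp
    rw [H] at h1
    simp [List.mem_replicate, Ne.symm hal, Ne.symm hbl, Ne.symm hcl, hlr] at h1

namespace DoubleHeadPDA

variable {α : Type} {M : DoubleHeadPDA α}

theorem eq_of_word_mem_langDta {a b c l r : α} (hd : [a, b, c, l, r].Nodup)
    {σ : List (Head × α)} (H : word σ ∈ langDta a b c l r) {h : Head} {i j k : ℕ} {e : List α}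
    (hσ : h.proj σ =
      List.replicate i a ++ List.replicate j b ++ List.replicate k c ++ h.marker l r :: e) :
    i = j ∧ j = k := by
  cases h with
  | left =>
    rw [word, hσ, List.append_assoc (_ ++ _ ++ _), List.cons_append] at H
    exact eq_of_append_mem_langDta hd H
  | right =>
    have hd' : [a, b, c, r, l].Nodup := by
      simp only [List.nodup_cons, List.mem_cons, List.not_mem_nil, or_false, not_or] at hd ⊢
      tauto
    have H := reverse_mem_langDta H
    rw [word, List.reverse_append, List.reverse_reverse, hσ, List.append_assoc (_ ++ _ ++ _),
      List.cons_append] at H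
    exact eq_of_append_mem_langDta hd' H

/-- Some head reads the middle `m`. If it is the right one, the left head never gets past `u`. The
part behind `m` appears reversed because `v` is listed in the right head's reading order. -/
theorem word_eq_append_cons {σ : List (Head × α)} {u v : List α} {m : α}
    (H : word σ = u ++ m :: v.reverse) :
    (∃ e, Head.left.proj σ = u ++ m :: e) ∨
      (Head.left.proj σ <+: u ∧ ∃ e, Head.right.proj σ = v ++ m :: e) := by
  have key : ∀ w, (Head.right.proj σ).reverse = w ++ m :: v.reverse →
      Head.right.proj σ = v ++ m :: w.reverse := by
    intro w hw
    have := congrArg List.reverse hw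
    simpa using this
  rcases List.append_eq_append_iff.1 H with ⟨w, h1, h2⟩ | ⟨w, h1, h2⟩
  · exact Or.inr ⟨⟨w, h1.symm⟩, _, key w h2⟩
  · cases w with
    | nil => exact Or.inr ⟨⟨[], by simp [h1]⟩, _, key [] h2.symm⟩
    | cons x w =>
      obtain ⟨rfl, -⟩ := List.cons_eq_cons.1 h2
      exact Or.inl ⟨w, h1⟩

theorem word_eq_append_cons' {σ : List (Head × α)} {u v : List α} {m : α}
    (H : word σ = u ++ m :: v.reverse) :
    (∃ e, Head.right.proj σ = v ++ m :: e) ∨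
      (Head.right.proj σ <+: v ∧ ∃ e, Head.left.proj σ = u ++ m :: e) := by
  rcases List.append_eq_append_iff.1 H with ⟨w, h1, h2⟩ | ⟨w, h1, h2⟩
  · refine Or.inl ⟨w.reverse, ?_⟩
    have := congrArg List.reverse h2
    simpa using this
  · cases w with
    | nil => exact Or.inl ⟨[], by simpa using congrArg List.reverse h2.symm⟩
    | cons x w =>
      obtain ⟨rfl, h3⟩ := List.cons_eq_cons.1 h2
      exact Or.inr ⟨⟨w.reverse, by simpa using (congrArg List.reverse h3).symm⟩, w, h1⟩

theorem Deterministic.head_eq (hM : M.Deterministic) {h h' : Head} {x x' : α}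
    {q q₁ q₂ : M.State} {s s₁ s₂ : List M.Stack} (H : M.Move none h x q s q₁ s₁)
    (H' : M.Move none h' x' q s q₂ s₂) : h = h' := by
  cases h <;> cases h'
  · rfl
  · exact (hM _ _ _ _ _ (H.step [x']) (H'.step [x])).1
  · exact (hM _ _ _ _ _ (H.step [x']) (H'.step [x])).1
  · rfl

theorem Deterministic.move_eq (hM : M.Deterministic) {h : Head} {x : α}
    {q q₁ q₂ : M.State} {s s₁ s₂ : List M.Stack} (H : M.Move none h x q s q₁ s₁)
    (H' : M.Move none h x q s q₂ s₂) : q₁ = q₂ ∧ s₁ = s₂ := by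
  have := (hM _ _ _ _ _ (H.step []) (H'.step [])).2
  simpa using this

/-- A deterministic automaton cannot let the right head arrive at one symbol first, and the left
head at another symbol in the same place. -/
theorem Deterministic.not_both (hM : M.Deterministic) {l r : α} {σ σ' : List (Head × α)}
    {u v : List α} {q p p' : M.State} {s t t' : List M.Stack}
    (H : M.RunOver none q s σ p t) (H' : M.RunOver none q s σ' p' t')
    (hu : Head.left.proj σ <+: u) (hv : ∃ e, Head.right.proj σ = v ++ l :: e)
    (hv' : Head.right.proj σ' <+: v) (hu' : ∃ e, Head.left.proj σ' = u ++ r :: e) : False := by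
  obtain ⟨e, hv⟩ := hv
  obtain ⟨e', hu'⟩ := hu'
  induction σ generalizing σ' u v q s with
  | nil => simp [Head.proj] at hv
  | cons y σ ih =>
    cases H with
    | @cons _ _ _ _ _ _ h x _ hm hr =>
    cases H' with
    | nil => simp [Head.proj] at hu'
    | @cons _ _ _ _ _ _ h' x' σ' hm' hr' =>
      -- The two runs go in lockstep: the common head reads the next letter of `u` or of `v` in
      -- both, and determinism keeps the configurations equal. If that word is exhausted, the run
      -- that stays within it cannot move this head.
      have hh := hM.head_eq hm hm'
      subst hh
      cases h with
      | left =>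
        have e1 := proj_cons_opp Head.left x σ
        have e2 := proj_cons_opp Head.left x' σ'
        simp only [Head.opp] at e1 e2
        rw [proj_cons_same] at hu hu'
        rw [e1] at hv
        rw [e2] at hv'
        cases u with
        | nil => simp at hu
        | cons z u =>
          obtain ⟨rfl, hu⟩ := List.cons_prefix_cons.1 hu
          obtain ⟨rfl, hu'⟩ := List.cons_eq_cons.1 hu'
          obtain ⟨rfl, rfl⟩ := hM.move_eq hm hm'
          exact ih hr hr' ‹_› ‹_› ‹_› ‹_›
      | right =>
        have e1 := proj_cons_opp Head.right x σ
        have e2 := proj_cons_opp Head.right x' σ'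
        simp only [Head.opp] at e1 e2
        rw [proj_cons_same] at hv hv'
        rw [e1] at hu
        rw [e2] at hu'
        cases v with
        | nil => simp at hv'
        | cons z v =>
          obtain ⟨rfl, hv'⟩ := List.cons_prefix_cons.1 hv'
          obtain ⟨rfl, hv⟩ := List.cons_eq_cons.1 hv
          obtain ⟨rfl, rfl⟩ := hM.move_eq hm hm'
          exact ih hr hr' ‹_› ‹_› ‹_› ‹_›

/-- The final part of an accepting run above a fixed part with top `Z`: up to a return to that
part in the state `o`, or to the end. -/
def Finish (M : DoubleHeadPDA α) (Z : Option M.Stack) (p : M.State) (o : Option M.State)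
    (σ : List (Head × α)) : Prop :=
  (∃ q, o = some q ∧ M.RunOver Z p [] σ q []) ∨
    (o = none ∧ ∃ q s, q ∈ M.accept ∧ M.RunOver Z p [] σ q s)

/-- What is left of an accepting run after a return to the fixed part `b` in the state `o`. -/
def Rest (M : DoubleHeadPDA α) (b : List M.Stack) (o : Option M.State)
    (σ : List (Head × α)) : Prop :=
  (∃ q, o = some q ∧ ∃ q' s, q' ∈ M.accept ∧ M.RunOver none q b σ q' s) ∨ (o = none ∧ σ = [])

theorem Finish.append {b : List M.Stack} {p : M.State} {o : Option M.State}
    {σ τ : List (Head × α)} (H : M.Finish b.head? p o σ) (H' : M.Rest b o τ) :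
    ∃ q s, q ∈ M.accept ∧ M.RunOver none p b (σ ++ τ) q s := by
  rcases H with ⟨q, rfl, H⟩ | ⟨rfl, q, s, hq, H⟩
  · rcases H' with ⟨q', h, q'', s, hq, H'⟩ | ⟨h, -⟩
    · cases h
      exact ⟨q'', s, hq, RunOver.append (H.lift_none b) H'⟩
    · cases h
  · rcases H' with ⟨q', h, -⟩ | ⟨-, rfl⟩
    · cases h
    · exact ⟨q, _, hq, by simpa using H.lift_none b⟩

/-- The decomposition of an accepting run in which head `h` reads `a^n b^n c^n m`. The store is
at the same height before the second part, after it (while `b` is read), and after the third. -/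
structure BlockRun (M : DoubleHeadPDA α) (a b c m : α) (n : ℕ)
    (h : Head) (p₁ p₂ : M.State) (Z : Option M.Stack) (o : Option M.State) (f : Bool) where
  (σ₁ σ₂ σ₃ σ₄ : List (Head × α))
  (base : List M.Stack)
  (i₁ i₂ j₁ j₂ k₁ k₂ : ℕ)
  (e₁ e₂ : List α)
  top : base.head? = Z
  run₁ : M.RunOver none M.start [] σ₁ p₁ base
  run₂ : M.RunOver Z p₁ [] σ₂ p₂ []
  run₃ : M.Finish Z p₂ o σ₃
  run₄ : M.Rest base o σ₄
  proj₁ : h.proj σ₁ = List.replicate i₁ a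
  proj₂ : h.proj σ₂ = List.replicate i₂ a ++ List.replicate j₁ b
  proj₃ : h.proj σ₃ = List.replicate j₂ b ++ List.replicate k₁ c ++ cond f (m :: e₁) []
  proj₄ : h.proj σ₄ = cond f e₂ (List.replicate k₂ c ++ m :: e₂)
  eq₁ : i₁ + i₂ = n
  eq₂ : j₁ + j₂ = n
  eq₃ : cond f k₁ (k₁ + k₂) = n

/-- With `σ₂` taken from `D'`, the block `c^n` is unchanged, so `D'.j₁ + D.j₂ = n`. With `σ₃` taken
from `D'`, the block `a^n` is unchanged, so `D.j₁ + D'.j₂ = n`. Together with `D.j₁ + D.j₂ = n` this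
gives `n' = n`. -/
theorem BlockRun.eq {a b c l r : α} (hd : [a, b, c, l, r].Nodup)
    (hL : M.language = langDta a b c l r) {n n' : ℕ} {h : Head} {p₁ p₂ : M.State}
    {Z : Option M.Stack} {o : Option M.State} {f : Bool}
    (D : M.BlockRun a b c (h.marker l r) n h p₁ p₂ Z o f)
    (D' : M.BlockRun a b c (h.marker l r) n' h p₁ p₂ Z o f) : n = n' := by
  have acc : ∀ τ₂ τ₃ : List (Head × α), M.RunOver Z p₁ [] τ₂ p₂ [] → M.Finish Z p₂ o τ₃ →
      word (D.σ₁ ++ (τ₂ ++ (τ₃ ++ D.σ₄))) ∈ langDta a b c l r := by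
    intro τ₂ τ₃ h2 h3
    rw [← D.top] at h2 h3
    obtain ⟨q, s, hq, h4⟩ := h3.append D.run₄
    rw [← hL]
    exact mem_language_iff.2 ⟨_, q, s, hq, D.run₁.append
      (RunOver.append (h2.lift_none D.base) h4),
      rfl⟩
  have h1 := acc D'.σ₂ D.σ₃ D'.run₂ D.run₃
  have h2 := acc D.σ₂ D'.σ₃ D.run₂ D'.run₃
  have hn := D.eq₁
  have hn' := D.eq₂
  have hm := D'.eq₂
  have hk := D.eq₃
  obtain ⟨e, he⟩ : ∃ e, h.proj (D.σ₁ ++ (D'.σ₂ ++ (D.σ₃ ++ D.σ₄))) =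
      List.replicate (D.i₁ + D'.i₂) a ++ List.replicate (D'.j₁ + D.j₂) b ++
        List.replicate n c ++ h.marker l r :: e := by
    simp only [proj_append, D.proj₁, D'.proj₂, D.proj₃, D.proj₄]
    cases f
    · exact ⟨D.e₂, by
        have hk' : List.replicate n c = List.replicate D.k₁ c ++ List.replicate D.k₂ c := by
          rw [← List.replicate_add]; exact congrArg (List.replicate · c) hk.symm
        simp [hk', List.replicate_add, -List.replicate_append_replicate]⟩
    · exact ⟨D.e₁ ++ D.e₂, by
        have hk' : List.replicate n c = List.replicate D.k₁ c :=
          congrArg (List.replicate · c) hk.symm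
        simp [hk', List.replicate_add, -List.replicate_append_replicate]⟩
  obtain ⟨e', he'⟩ : ∃ e k, h.proj (D.σ₁ ++ (D.σ₂ ++ (D'.σ₃ ++ D.σ₄))) =
      List.replicate (D.i₁ + D.i₂) a ++ List.replicate (D.j₁ + D'.j₂) b ++
        List.replicate k c ++ h.marker l r :: e := by
    simp only [proj_append, D.proj₁, D.proj₂, D'.proj₃, D.proj₄]
    cases f
    · exact ⟨D.e₂, D'.k₁ + D.k₂, by
        simp [List.replicate_add, -List.replicate_append_replicate]⟩
    · exact ⟨D'.e₁ ++ D.e₂, D'.k₁, by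
        simp [List.replicate_add, -List.replicate_append_replicate]⟩
  obtain ⟨k, he'⟩ := he'
  have h3 := eq_of_word_mem_langDta hd h1 he
  have h4 := eq_of_word_mem_langDta hd h2 he'
  omega

/-- Here `base` is the lowest store content while `h` is in the block `b`. The segment `σ₂` begins
where the run last leaves this level during the block `a`, and `σ₃` lasts until the first return to
it after the block `b`, if there is one. -/
theorem exists_blockRun {a b c m : α} {n : ℕ} {h : Head} {σ : List (Head × α)} {q : M.State}
    {s : List M.Stack} {e : List α} (hq : q ∈ M.accept)
    (H : M.RunOver none M.start [] σ q s)
    (hσ : h.proj σ =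
      List.replicate n a ++ List.replicate n b ++ List.replicate n c ++ m :: e) :
    ∃ p₁ p₂ Z o f, Nonempty (M.BlockRun a b c m n h p₁ p₂ Z o f) := by
  rw [List.append_assoc, List.append_assoc] at hσ
  obtain ⟨σa, σ', rfl, ha, h'⟩ := exists_append_of_proj_eq hσ
  obtain ⟨σb, σc, rfl, hb, hc⟩ := exists_append_of_proj_eq h'
  obtain ⟨q₁, s₁, Ha, H⟩ := H.exists_of_append
  obtain ⟨q₂, s₂, Hb, Hc⟩ := H.exists_of_append
  obtain ⟨τ₁, τ₂, p, t₁, t₂, base, rfl, rfl, rfl, h1, h2⟩ := Hb.exists_min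
  obtain ⟨ρ₁, ρ₂, p₁, rfl, h3, h4⟩ := Ha.exists_last_above
  rw [proj_append] at ha hb
  obtain ⟨ha', ha1, ha2⟩ := List.append_eq_replicate_iff.1 ha
  obtain ⟨hb', hb1, hb2⟩ := List.append_eq_replicate_iff.1 hb
  obtain ⟨o, κ₁, κ₂, rfl, h5, h6⟩ : ∃ o κ₁ κ₂, σc = κ₁ ++ κ₂ ∧
      M.Finish base.head? p o (τ₂ ++ κ₁) ∧ M.Rest base o κ₂ := by
    rcases Hc.above_or_return with ⟨s', h5⟩ | ⟨κ₁, κ₂, p', rfl, h5, h6⟩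
    · exact ⟨none, σc, [], by simp, Or.inr ⟨rfl, q, _, hq, h2.append h5⟩, Or.inr ⟨rfl, rfl⟩⟩
    · exact ⟨some p', κ₁, κ₂, rfl, Or.inl ⟨p', rfl, h2.append h5⟩,
        Or.inl ⟨p', rfl, q, s, hq, h6⟩⟩
  -- The flag `f` tells whether `h` reads the marker before the return. If so, all of `c^n` lies in
  -- `σ₃` and `k₂` is a dummy; otherwise `e₁` is a dummy.
  obtain ⟨f, k₁, k₂, e₁, e₂, hk, hp3, hp4⟩ : ∃ (f : Bool) (k₁ k₂ : ℕ) (e₁ e₂ : List α),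
      cond f k₁ (k₁ + k₂) = n ∧ h.proj κ₁ = List.replicate k₁ c ++ cond f (m :: e₁) [] ∧
      h.proj κ₂ = cond f e₂ (List.replicate k₂ c ++ m :: e₂) := by
    rw [proj_append] at hc
    rcases List.append_eq_append_iff.1 hc with ⟨w, h7, h8⟩ | ⟨w, h7, h8⟩
    · obtain ⟨h9, h10, h11⟩ := List.append_eq_replicate_iff.1 h7.symm
      exact ⟨false, (h.proj κ₁).length, w.length, [], e, h9, by simpa using h10,
        by rw [h8]; simpa using h11⟩
    · cases w with
      | nil => exact ⟨false, n, 0, [], e, rfl, by simpa using h7, by simpa using h8.symm⟩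
      | cons x w =>
        obtain ⟨rfl, h8⟩ := List.cons_eq_cons.1 h8
        exact ⟨true, n, 0, w, h.proj κ₂, rfl, by simpa using h7, rfl⟩
  exact ⟨p₁, p, base.head?, o, f, ⟨{
    σ₁ := ρ₁, σ₂ := ρ₂ ++ τ₁, σ₃ := τ₂ ++ κ₁, σ₄ := κ₂, base := base
    i₁ := (h.proj ρ₁).length, i₂ := (h.proj ρ₂).length
    j₁ := (h.proj τ₁).length, j₂ := (h.proj τ₂).length
    k₁ := k₁, k₂ := k₂, e₁ := e₁, e₂ := e₂
    top := rfl, run₁ := h3, run₂ := h4.append h1, run₃ := h5, run₄ := h6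
    proj₁ := ha1
    proj₂ := by rw [proj_append, ← ha2, ← hb1]
    proj₃ := by rw [proj_append, hp3, ← hb2, List.append_assoc]
    proj₄ := hp4
    eq₁ := ha', eq₂ := hb', eq₃ := hk }⟩⟩

/-- Otherwise the right head would be the one to reach `l` and the left head the one to reach `r`
between the same `u` and its reversal, which `not_both` excludes. -/
theorem exists_reads_marker (hM : M.Deterministic) {a b c l r : α}
    (hL : M.language = langDta a b c l r) (n : ℕ) :
    ∃ h σ q s e, q ∈ M.accept ∧ M.RunOver none M.start [] σ q s ∧ h.proj σ =
      List.replicate n a ++ List.replicate n b ++ List.replicate n c ++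
        Head.marker l r h :: e := by
  set u := List.replicate n a ++ List.replicate n b ++ List.replicate n c with hu
  have h1 : u ++ l :: u.reverse ∈ M.language := by
    rw [hL]; exact Or.inl ⟨n, n, n, n, by simp [hu]⟩
  have h2 : u ++ r :: u.reverse ∈ M.language := by
    rw [hL]; exact Or.inr ⟨n, n, n, n, by simp [hu]⟩
  obtain ⟨σ, q, s, hq, H, hw⟩ := mem_language_iff.1 h1
  obtain ⟨σ', q', s', hq', H', hw'⟩ := mem_language_iff.1 h2
  rcases word_eq_append_cons hw with ⟨e, he⟩ | ⟨h3, h4⟩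
  · exact ⟨.left, σ, q, s, e, hq, H, he⟩
  rcases word_eq_append_cons' hw' with ⟨e, he⟩ | ⟨h5, h6⟩
  · exact ⟨.right, σ', q', s', e, hq', H', he⟩
  exact (hM.not_both H H' h3 h4 h5 h6).elim

theorem finite_head : Finite Head :=
  Finite.of_surjective (fun x : Bool => cond x Head.left Head.right) (by
    rintro (_ | _)
    · exact ⟨true, rfl⟩
    · exact ⟨false, rfl⟩)

theorem langDta_notMem_detDoubleFamily {a b c l r : α} (hd : [a, b, c, l, r].Nodup) :
    langDta a b c l r ∉ DetDoubleFamily α := by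
  rintro ⟨M, hM, hL⟩
  have key : ∀ n : ℕ, ∃ x : Head × M.State × M.State × Option M.Stack × Option M.State × Bool,
      Nonempty (M.BlockRun a b c (x.1.marker l r) n x.1 x.2.1 x.2.2.1 x.2.2.2.1 x.2.2.2.2.1
        x.2.2.2.2.2) := by
    intro n
    obtain ⟨h, σ, q, s, e, hq, H, he⟩ := exists_reads_marker hM hL n
    obtain ⟨p₁, p₂, Z, o, f, hD⟩ := exists_blockRun hq H he
    exact ⟨(h, p₁, p₂, Z, o, f), hD⟩
  choose x hx using key
  have := finite_head
  have := M.finite_state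
  have := M.finite_stack
  obtain ⟨n, n', hne, hxx⟩ := Finite.exists_ne_map_eq_of_infinite x
  obtain ⟨D⟩ := hx n
  obtain ⟨D'⟩ := hx n'
  rw [← hxx] at D'
  exact hne (BlockRun.eq hd hL D D')

end DoubleHeadPDA

/-! ### `langTa` is not accepted with a single signature -/

theorem le_of_replicate_append_eq {α : Type} {a b : α} (hab : a ≠ b) {k n : ℕ} {t t' : List α}
    (H : List.replicate k a ++ t = List.replicate n a ++ b :: t') : k ≤ n := by
  induction k generalizing n with
  | zero => exact Nat.zero_le n
  | succ k ih =>
    cases n with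
    | zero => simp [List.replicate_succ, hab] at H
    | succ n =>
      rw [List.replicate_succ, List.replicate_succ] at H
      exact Nat.succ_le_succ (ih (List.cons_eq_cons.1 H).2)

theorem reverse_mem_langTa {α : Type} {a b : α} {w : List α} (H : w ∈ langTa a b) :
    w.reverse ∈ langTa a b := by
  obtain ⟨n, hn, rfl⟩ := H
  exact ⟨n, hn, by simp⟩

theorem count_of_mem_langTa {α : Type} [DecidableEq α] {a b : α} (hab : a ≠ b) {w : List α}
    (H : w ∈ langTa a b) : w.count a = 2 * w.count b := by
  obtain ⟨n, hn, rfl⟩ := H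
  simp [List.count_replicate, hab, Ne.symm hab]
  omega

/-- A prefix of letters `a` ends at the first `b`, which exists since `n ≥ 1`, and `n` is the number
of letters `b`. -/
theorem le_count_of_mem_langTa {α : Type} [DecidableEq α] {a b : α} (hab : a ≠ b) {k : ℕ}
    {t : List α} (H : List.replicate k a ++ t ∈ langTa a b) :
    k ≤ (List.replicate k a ++ t).count b := by
  obtain ⟨n, hn, H⟩ := H
  have h1 : (List.replicate k a ++ t).count b = n := by
    rw [H]
    simp [List.count_replicate, hab]
  obtain ⟨m, rfl⟩ := Nat.exists_eq_add_of_le' hn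
  rw [h1]
  rw [List.append_assoc, List.replicate_succ (a := b), List.cons_append] at H
  exact le_of_replicate_append_eq hab H

namespace DoubleHeadPDA

variable {α : Type} {M : DoubleHeadPDA α}

theorem length_proj_le_of_word_mem_langTa [DecidableEq α] {a b : α} (hab : a ≠ b)
    {σ τ : List (Head × α)} (h : Head) (hσ : h.proj σ = List.replicate (h.proj σ).length a)
    (H : word (σ ++ τ) ∈ langTa a b) :
    (h.proj σ).length ≤ ((σ ++ τ).map Prod.snd).count b := by
  rw [← count_word]
  cases h with
  | left =>
    rw [word, proj_append, List.append_assoc] at H ⊢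
    rw [hσ] at H ⊢
    simpa using le_count_of_mem_langTa hab H
  | right =>
    have H := reverse_mem_langTa H
    rw [← List.count_reverse]
    rw [word, List.reverse_append, List.reverse_reverse, proj_append, List.append_assoc] at H ⊢
    rw [hσ] at H ⊢
    simpa using le_count_of_mem_langTa hab H

theorem proj_eq_replicate {σ : List (Head × α)} {a : α} (h : Head)
    (H : ∀ x ∈ σ.map Prod.snd, x = a) : h.proj σ = List.replicate (h.proj σ).length a := by
  refine List.eq_replicate_iff.2 ⟨rfl, fun x hx => H x ?_⟩
  rw [← mem_word, word]
  cases h <;> simp [hx]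

theorem length_proj_le (h : Head) (σ : List (Head × α)) : (h.proj σ).length ≤ σ.length :=
  List.length_filterMap_le _ _

/-- The decomposition of an accepting run on `a^n b^n a^n`: the second part starts and ends at
the same height, and head `h` reads `a^n` before anything else is read by either head. -/
structure NestedRun (M : DoubleHeadPDA α) [DecidableEq α] (a b : α) (n : ℕ)
    (h : Head) (p₁ p₂ : M.State) (Z : Option M.Stack) where
  (σ₁ σ₂ σ₃ : List (Head × α))
  (τ τ' : List (Head × α))
  (base : List M.Stack)
  top : base.head? = Z
  run₁ : M.RunOver none M.start [] σ₁ p₁ base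
  run₂ : M.RunOver Z p₁ [] σ₂ p₂ []
  run₃ : ∃ q s, q ∈ M.accept ∧ M.RunOver Z p₂ [] σ₃ q s
  split : σ₂ = τ ++ τ'
  all : ∀ x ∈ (σ₁ ++ τ).map Prod.snd, x = a
  le_length : n ≤ (h.proj (σ₁ ++ τ)).length
  balanced : (σ₂.map Prod.snd).count a = (σ₂.map Prod.snd).count b
  total : ((σ₁ ++ (σ₂ ++ σ₃)).map Prod.snd).count b = n

/-- Exchanging `σ₂` changes the numbers of `a` and `b` by the same amount, but the former must
remain twice the latter; so both `σ₂` contain equally many `b`. Taking `σ₃` from `D'` then gives a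
word with `n'` letters `b`, in which `h` still reads at least `n` letters `a` first. -/
theorem NestedRun.le [DecidableEq α] {a b : α} (hab : a ≠ b) (hL : M.language = langTa a b)
    {n n' : ℕ} {h : Head} {p₁ p₂ : M.State} {Z : Option M.Stack}
    (D : M.NestedRun a b n h p₁ p₂ Z) (D' : M.NestedRun a b n' h p₁ p₂ Z) : n ≤ n' := by
  have acc : ∀ {n₁ n₂ n₃ : ℕ} (D₁ : M.NestedRun a b n₁ h p₁ p₂ Z)
      (D₂ : M.NestedRun a b n₂ h p₁ p₂ Z) (D₃ : M.NestedRun a b n₃ h p₁ p₂ Z),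
      word (D₁.σ₁ ++ (D₂.σ₂ ++ D₃.σ₃)) ∈ langTa a b := by
    intro _ _ _ D₁ D₂ D₃
    obtain ⟨q, s, hq, h3⟩ := D₃.run₃
    have h4 : M.RunOver D₁.base.head? p₁ [] (D₂.σ₂ ++ D₃.σ₃) q s := by
      rw [D₁.top]
      exact D₂.run₂.append h3
    rw [← hL]
    exact mem_language_iff.2 ⟨_, q, _, hq, D₁.run₁.append (h4.lift_none D₁.base), rfl⟩
  have c1 := count_of_mem_langTa hab (acc D D D)
  have c2 := count_of_mem_langTa hab (acc D' D D)
  have c3 := count_of_mem_langTa hab (acc D D D')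
  have c4 := count_of_mem_langTa hab (acc D' D' D')
  have z : ∀ {n₁ : ℕ} (E : M.NestedRun a b n₁ h p₁ p₂ Z),
      (E.σ₁.map Prod.snd).count b = 0 := by
    intro _ E
    refine List.count_eq_zero.2 fun hb => hab ?_
    exact (E.all b (by rw [List.map_append]; exact List.mem_append_left _ hb)).symm
  have z1 := z D
  have z2 := z D'
  have hb1 := D.balanced
  have hb2 := D'.balanced
  have t1 := D.total
  have t2 := D'.total
  have key : (h.proj (D.σ₁ ++ D.τ)).length ≤
      ((D.σ₁ ++ D.τ ++ (D.τ' ++ D'.σ₃)).map Prod.snd).count b := by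
    refine length_proj_le_of_word_mem_langTa hab h (proj_eq_replicate h D.all) ?_
    have := (acc D D D')
    rw [D.split] at this
    simpa using this
  have e : D.σ₁ ++ D.τ ++ (D.τ' ++ D'.σ₃) = D.σ₁ ++ (D.σ₂ ++ D'.σ₃) := by simp [D.split]
  rw [e] at key
  have hn := D.le_length
  simp only [count_word, List.map_append, List.count_append] at c1 c2 c3 c4 t1 t2 key z1 z2
  omega

theorem RunOver.eq_nil {a : α} (ha : ∀ h, M.signature h a ≠ StackOp.push)
    {q q' : M.State} {s' : List M.Stack} {σ : List (Head × α)}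
    (H : M.RunOver none q [] σ q' s') (hσ : ∀ x ∈ σ.map Prod.snd, x = a) : s' = [] := by
  induction σ generalizing q with
  | nil => cases H; rfl
  | cons y σ ih =>
    cases H with
    | @cons _ _ _ _ _ _ h x _ hm hr =>
      have hx : x = a := hσ x (by simp)
      subst hx
      have hσ' : ∀ y ∈ σ.map Prod.snd, y = x := fun y hy =>
        hσ y (by rw [List.map_cons]; exact List.mem_cons_of_mem _ hy)
      cases hm with
      | push h1 _ => exact absurd h1 (ha h)
      | pop _ _ _ => exact ih hr hσ'
      | keep _ _ => exact ih hr hσ'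

/-- Without pops, a run never goes below its initial store. -/
theorem RunOver.above_of_forall_ne_pop {q q' : M.State} {t b s' : List M.Stack}
    {σ : List (Head × α)} (H : M.RunOver none q (t ++ b) σ q' s')
    (hσ : ∀ h, ∀ x ∈ σ.map Prod.snd, M.signature h x ≠ StackOp.pop) :
    ∃ s₂, M.RunOver b.head? q t σ q' s₂ := by
  induction σ generalizing q t with
  | nil => cases H; exact ⟨t, .nil _ _⟩
  | cons y σ ih =>
    have hσ' : ∀ h, ∀ y ∈ σ.map Prod.snd, M.signature h y ≠ StackOp.pop := fun h y hy =>
      hσ h y (by rw [List.map_cons]; exact List.mem_cons_of_mem _ hy)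
    cases H with
    | @cons _ _ _ _ _ _ h x _ hm hr =>
      cases hm with
      | @push _ _ z ha ht =>
        obtain ⟨s₂, h2⟩ := ih (t := z :: t) hr hσ'
        exact ⟨s₂, .cons (.push ha (by rwa [or_head?_append] at ht)) h2⟩
      | pop ha _ _ => exact absurd ha (hσ h x (by simp))
      | keep ha ht =>
        obtain ⟨s₂, h2⟩ := ih hr hσ'
        exact ⟨s₂, .cons (.keep ha (by rwa [or_head?_append] at ht)) h2⟩

/-- The bound `hs` ensures that no pop meets an empty store, where the height would not drop. -/
theorem RunOver.length_add_count [DecidableEq α] {a b : α} (hab : a ≠ b)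
    (ha : ∀ h, M.signature h a = StackOp.push) (hb : ∀ h, M.signature h b = StackOp.pop)
    {q q' : M.State} {s s' : List M.Stack} {σ : List (Head × α)}
    (H : M.RunOver none q s σ q' s') (hσ : ∀ x ∈ σ.map Prod.snd, x = a ∨ x = b)
    (hs : (σ.map Prod.snd).count b ≤ s.length) :
    s'.length + (σ.map Prod.snd).count b = s.length + (σ.map Prod.snd).count a := by
  induction σ generalizing q s with
  | nil => cases H; simp
  | cons y σ ih =>
    have hσ' : ∀ y ∈ σ.map Prod.snd, y = a ∨ y = b := fun y hy =>
      hσ y (by rw [List.map_cons]; exact List.mem_cons_of_mem _ hy)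
    cases H with
    | @cons _ _ _ _ _ _ h x _ hm hr =>
      rcases hσ x (by simp) with rfl | rfl
      · simp only [List.map_cons, List.count_cons_self, List.count_cons_of_ne hab] at hs ⊢
        cases hm with
        | push _ _ =>
          have := ih hr hσ' (by rw [List.length_cons]; omega)
          rw [List.length_cons] at this
          omega
        | pop h1 _ _ => simp [ha h] at h1
        | keep h1 _ => simp [ha h] at h1
      · simp only [List.map_cons, List.count_cons_self, List.count_cons_of_ne hab.symm] at hs ⊢
        cases hm with
        | push h1 _ => simp [hb h] at h1
        | pop _ _ _ =>
          have := ih hr hσ' (by rw [List.length_tail]; omega)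
          rw [List.length_tail] at this
          omega
        | keep h1 _ => simp [hb h] at h1

/-- The cut is just before the first `b` read by either head. The head reading that `b` has already
passed its whole outer block. -/
theorem exists_first_read {a b : α} (hab : a ≠ b) {n : ℕ} (hn : 1 ≤ n) {σ : List (Head × α)}
    (H : word σ = List.replicate n a ++ List.replicate n b ++ List.replicate n a) :
    ∃ σ₁ σ₂ h, σ = σ₁ ++ σ₂ ∧ (∀ x ∈ σ₁.map Prod.snd, x = a) ∧
      n ≤ (Head.proj h σ₁).length := by
  obtain ⟨m, rfl⟩ := Nat.exists_eq_add_of_le' hn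
  have hb : b ∈ σ.map Prod.snd := by
    rw [← mem_word, H]
    simp
  have hx : ∀ x ∈ σ.map Prod.snd, x = a ∨ x = b := by
    intro x hx
    rw [← mem_word, H] at hx
    simp only [List.mem_append, List.mem_replicate] at hx
    tauto
  obtain ⟨u, v, huv, hu⟩ := List.eq_append_cons_of_mem hb
  obtain ⟨σ₁, σ₂, rfl, rfl, h2⟩ := List.map_eq_append_iff.1 huv
  obtain ⟨⟨h, y⟩, σ₂, rfl, h3, rfl⟩ := List.map_eq_cons_iff.1 h2
  simp only at h3
  subst h3
  have hall : ∀ x ∈ σ₁.map Prod.snd, x = a := by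
    intro x h4
    rcases hx x (by rw [List.map_append]; exact List.mem_append_left _ h4) with h5 | h5
    · exact h5
    · exact absurd (h5 ▸ h4) hu
  refine ⟨σ₁, (h, y) :: σ₂, h, rfl, hall, ?_⟩
  cases h with
  | left =>
    rw [word, proj_append, proj_cons_same, proj_eq_replicate Head.left hall] at H
    simp only [List.append_assoc, List.cons_append] at H
    exact le_of_replicate_append_eq hab H.symm
  | right =>
    have H := congrArg List.reverse H
    rw [word, proj_append, proj_append, proj_cons_same, proj_eq_replicate Head.right hall] at H
    simp only [List.reverse_append, List.reverse_reverse, List.reverse_replicate,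
      List.append_assoc, List.cons_append] at H
    exact le_of_replicate_append_eq hab H.symm

/-- If `a` is not pushed, the store is empty at the first `b`; if `b` is not popped, the store never
shrinks from there on. In both cases `σ₂` can be empty. Otherwise `σ₂` runs from the last visit,
before the first `b`, to the level of the later minimum, up to that minimum. Its ends have equal
height, so it is balanced. -/
theorem exists_nestedRun [DecidableEq α] (hM : M.SingleSignature) {a b : α} (hab : a ≠ b)
    (hL : M.language = langTa a b) {n : ℕ} (hn : 1 ≤ n) :
    ∃ h p₁ p₂ Z, Nonempty (M.NestedRun a b n h p₁ p₂ Z) := by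
  have hw : List.replicate n a ++ List.replicate n b ++ List.replicate n a ∈ M.language := by
    rw [hL]
    exact ⟨n, hn, rfl⟩
  have hsig : ∀ h h' x, M.signature h x = M.signature h' x := by
    intro h h' x
    have := congrFun hM x
    cases h <;> cases h' <;> simp [this]
  obtain ⟨σ, q, s, hq, H, hσ⟩ := mem_language_iff.1 hw
  have hcount : (σ.map Prod.snd).count b = n := by
    rw [← count_word, hσ]
    simp [List.count_replicate, hab]
  have hx : ∀ x ∈ σ.map Prod.snd, x = a ∨ x = b := by
    intro x hx
    rw [← mem_word, hσ] at hx
    simp only [List.mem_append, List.mem_replicate] at hx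
    tauto
  obtain ⟨σ₁, σ₂, h, rfl, hall, hlen⟩ := exists_first_read hab hn hσ
  obtain ⟨p, t, H₁, H₂⟩ := H.exists_of_append
  have easy : (∃ q s, q ∈ M.accept ∧ M.RunOver t.head? p [] σ₂ q s) →
      ∃ h p₁ p₂ Z, Nonempty (M.NestedRun a b n h p₁ p₂ Z) := fun h₂ =>
    ⟨h, p, p, t.head?, ⟨{
      σ₁ := σ₁, σ₂ := [], σ₃ := σ₂, τ := [], τ' := [], base := t
      top := rfl, run₁ := H₁, run₂ := .nil _ _, run₃ := h₂, split := rfl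
      all := by simpa using hall
      le_length := by simpa using hlen
      balanced := rfl
      total := by simpa using hcount }⟩⟩
  by_cases ha : M.signature h a = StackOp.push
  swap
  · have ht : t = [] := H₁.eq_nil (fun h' => by rwa [hsig h' h]) hall
    subst ht
    exact easy ⟨q, s, hq, H₂⟩
  by_cases hb : M.signature h b = StackOp.pop
  swap
  · obtain ⟨s₂, h3⟩ := RunOver.above_of_forall_ne_pop (t := []) H₂ (by
      intro h' x h4
      rw [hsig h' h]
      rcases hx x (by rw [List.map_append]; exact List.mem_append_right _ h4) with rfl | rfl
      · rw [ha]; simp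
      · exact hb)
    exact easy ⟨q, s₂, hq, h3⟩
  obtain ⟨τ₁, τ₂, p', t₁, t₂, base, rfl, rfl, rfl, h1, h2⟩ := H₂.exists_min
  obtain ⟨ρ₁, ρ₂, p₁, rfl, h3, h4⟩ := H₁.exists_last_above
  have hlen' := hlen.trans (length_proj_le h _)
  simp only [List.map_append, List.mem_append, List.count_append] at hx hall hcount
  have len : ∀ {q q' : M.State} {s s' : List M.Stack} {σ : List (Head × α)},
      M.RunOver none q s σ q' s' → (∀ x ∈ σ.map Prod.snd, x = a ∨ x = b) →
      (σ.map Prod.snd).count b ≤ s.length →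
      s'.length + (σ.map Prod.snd).count b = s.length + (σ.map Prod.snd).count a :=
    RunOver.length_add_count hab (fun h' => by rw [hsig h' h, ha]) fun h' => by rw [hsig h' h, hb]
  have z : ∀ σ : List (Head × α), (∀ x ∈ σ.map Prod.snd, x = a) →
      (σ.map Prod.snd).count b = 0 ∧ (σ.map Prod.snd).count a = σ.length := by
    intro σ h5
    refine ⟨List.count_eq_zero.2 fun h6 => hab (h5 b h6).symm, ?_⟩
    rw [List.count_eq_length.2 fun x h6 => (h5 x h6).symm, List.length_map]
  have z1 := z ρ₁ fun x h5 => hall x (Or.inl h5)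
  have z2 := z ρ₂ fun x h5 => hall x (Or.inr h5)
  have l1 := len h3 (fun x h5 => Or.inl (hall x (Or.inl h5))) (by simp [z1.1])
  have l2 := len (h4.lift_none base) (fun x h5 => Or.inl (hall x (Or.inr h5))) (by simp [z2.1])
  simp only [List.length_append, List.length_nil] at l1 l2 hlen'
  -- At the first `b` the store holds at least `n` symbols and only `n` letters `b` are to come, so
  -- no pop underflows.
  have l3 := len (h1.lift_none base) (fun x h5 => hx x (Or.inr (Or.inl h5)))
    (by rw [List.length_append]; omega)
  simp only [List.length_append, List.length_nil] at l3
  refine ⟨h, p₁, p', base.head?, ⟨{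
    σ₁ := ρ₁, σ₂ := ρ₂ ++ τ₁, σ₃ := τ₂, τ := ρ₂, τ' := τ₁, base := base
    top := rfl, run₁ := h3, run₂ := h4.append h1, run₃ := ⟨q, t₂, hq, h2⟩, split := rfl
    all := by simpa only [List.map_append, List.mem_append] using hall
    le_length := hlen
    balanced := ?_
    total := ?_ }⟩⟩
  · simp only [List.map_append, List.count_append]
    omega
  · simp only [List.map_append, List.count_append]
    omega

theorem langTa_notMem_nondetSingleFamily {a b : α} (hab : a ≠ b) :
    langTa a b ∉ NondetSingleFamily α := by
  classical
  rintro ⟨M, hM, hL⟩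
  have key : ∀ n : ℕ, ∃ x : Head × M.State × M.State × Option M.Stack,
      Nonempty (M.NestedRun a b (n + 1) x.1 x.2.1 x.2.2.1 x.2.2.2) := by
    intro n
    obtain ⟨h, p₁, p₂, Z, hD⟩ := exists_nestedRun hM hab hL (Nat.le_add_left 1 n)
    exact ⟨(h, p₁, p₂, Z), hD⟩
  choose x hx using key
  have := finite_head
  have := M.finite_state
  have := M.finite_stack
  obtain ⟨n, n', hne, hxx⟩ := Finite.exists_ne_map_eq_of_infinite x
  obtain ⟨D⟩ := hx n
  obtain ⟨D'⟩ := hx n'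
  rw [← hxx] at D'
  have h1 := NestedRun.le hab hL D D'
  have h2 := NestedRun.le hab hL D' D
  omega

end DoubleHeadPDA

/-! ### A deterministic automaton with two signatures for `langTa` -/

namespace DoubleHeadPDA

variable {α : Type}

/-- `a` is pushed, `b` is popped, and everything else leaves the pushdown store unchanged. -/
noncomputable def pushPop (a b x : α) : StackOp :=
  open Classical in if x = a then .push else if x = b then .pop else .keep

theorem pushPop_left (a b : α) : pushPop a b a = .push := by simp [pushPop]

theorem pushPop_right {a b : α} (hab : a ≠ b) : pushPop a b b = .pop := by
  simp [pushPop, hab.symm]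

theorem pushPop_of_ne {a b x : α} (ha : x ≠ a) (hb : x ≠ b) : pushPop a b x = .keep := by
  simp [pushPop, ha, hb]

theorem eq_of_pushPop_eq_push {a b x : α} (H : pushPop a b x = .push) : x = a := by
  unfold pushPop at H
  split_ifs at H
  assumption

theorem eq_of_pushPop_eq_pop {a b x : α} (H : pushPop a b x = .pop) : x = b := by
  unfold pushPop at H
  split_ifs at H
  assumption

/-- The automaton accepts when it is started in the configuration. -/
def AcceptsFrom (M : DoubleHeadPDA α) (c : M.Config) : Prop :=
  ∃ q s, q ∈ M.accept ∧ M.Reaches c (q, [], s)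

theorem AcceptsFrom.of_step {M : DoubleHeadPDA α} {h : Head} {c c' : M.Config}
    (H : M.Step h c c') (H' : M.AcceptsFrom c') : M.AcceptsFrom c := by
  obtain ⟨q, s, hq, h1⟩ := H'
  exact ⟨q, s, hq, .head ⟨h, H⟩ h1⟩

theorem AcceptsFrom.of_mem {M : DoubleHeadPDA α} {q : M.State} {s : List M.Stack}
    (H : q ∈ M.accept) : M.AcceptsFrom (q, [], s) :=
  ⟨q, s, H, .refl⟩

theorem AcceptsFrom.induction {M : DoubleHeadPDA α} {P : M.Config → Prop}
    (h₀ : ∀ q ∈ M.accept, ∀ s, P (q, [], s))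
    (h₁ : ∀ h c c', M.Step h c c' → P c' → P c) {c : M.Config} (H : M.AcceptsFrom c) : P c := by
  obtain ⟨q, s, hq, H⟩ := H
  induction H using Relation.ReflTransGen.head_induction_on with
  | refl => exact h₀ q hq s
  | head h2 _ ih =>
    obtain ⟨h, h2⟩ := h2
    exact h₁ h _ _ h2 ih

/-- The states of the automaton for `langTa`. -/
inductive TaState where
  | init
  | opp
  | back
  | drop
  | done

theorem finite_taState : Finite TaState :=
  Finite.of_injective
    (fun | .init => (0 : Fin 5) | .opp => 1 | .back => 2 | .drop => 3 | .done => 4)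
    (by intro x y; cases x <;> cases y <;> simp)

/-- The left head pushes `a` and the right head keeps `a`, alternately; then the left head pops
the store with `b`. The bottom symbol is `true`. -/
noncomputable def taPDA (a b : α) : DoubleHeadPDA α where
  State := TaState
  Stack := Bool
  finite_state := finite_taState
  finite_stack := inferInstance
  signature h x := match h with
    | .left => pushPop a b x
    | .right => .keep
  start := .init
  accept := {.done}
  deltaD q h _ _ := {p | h = .left ∧
    ((q = .init ∧ p = (.opp, true)) ∨ (q = .back ∧ p = (.opp, false)))}
  deltaR q h _ z := {p | h = .left ∧ (q = .back ∨ q = .drop) ∧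
    ((z = some true ∧ p = .done) ∨ (z = some false ∧ p = .drop))}
  deltaN q h x _ := {p | h = .right ∧ x = a ∧ q = .opp ∧ p = .back}

/-- The state fixes the head: only `opp` moves the right one. The letter then fixes the operation,
and the top symbol fixes the outcome of a pop. -/
theorem taPDA_deterministic (a b : α) : (taPDA a b).Deterministic := by
  rintro c c₁ c₂ h₁ h₂ H₁ H₂
  cases H₁ with
  | push hv ha ht =>
    obtain ⟨rfl, ht⟩ := ht
    subst hv
    generalize e : Head.left.attach _ _ = v at H₂
    cases H₂ with
    | push hv' ha' ht' =>
      obtain ⟨rfl, ht'⟩ := ht'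
      subst e
      obtain ⟨rfl, rfl⟩ := List.cons_eq_cons.1 hv'
      refine ⟨rfl, ?_⟩
      rcases ht with ⟨rfl, hp⟩ | ⟨rfl, hp⟩ <;> rcases ht' with ⟨h, hp'⟩ | ⟨h, hp'⟩ <;>
        cases hp <;> cases hp' <;> first | rfl | cases h
    | pop hv' ha' ht' =>
      obtain ⟨rfl, ht'⟩ := ht'
      subst e
      obtain ⟨rfl, rfl⟩ := List.cons_eq_cons.1 hv'
      exact nomatch ha.symm.trans ha'
    | keep hv' ha' ht' =>
      obtain ⟨rfl, rfl, rfl, rfl⟩ := ht'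
      simp at ht
  | pop hv ha ht =>
    obtain ⟨rfl, hq, ht⟩ := ht
    subst hv
    generalize e : Head.left.attach _ _ = v at H₂
    cases H₂ with
    | push hv' ha' ht' =>
      obtain ⟨rfl, ht'⟩ := ht'
      subst e
      obtain ⟨rfl, rfl⟩ := List.cons_eq_cons.1 hv'
      exact nomatch ha.symm.trans ha'
    | pop hv' ha' ht' =>
      obtain ⟨rfl, -, ht'⟩ := ht'
      subst e
      obtain ⟨rfl, rfl⟩ := List.cons_eq_cons.1 hv'
      refine ⟨rfl, ?_⟩
      rcases ht with ⟨h, rfl⟩ | ⟨h, rfl⟩ <;> rcases ht' with ⟨h', rfl⟩ | ⟨h', rfl⟩ <;>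
        first | rfl | exact nomatch h.symm.trans h'
    | keep hv' ha' ht' =>
      obtain ⟨rfl, rfl, rfl, rfl⟩ := ht'
      simp at hq
  | keep hv ha ht =>
    obtain ⟨rfl, rfl, rfl, rfl⟩ := ht
    subst hv
    generalize e : Head.right.attach _ _ = v at H₂
    cases H₂ with
    | push hv' ha' ht' =>
      obtain ⟨rfl, ht'⟩ := ht'
      simp at ht'
    | pop hv' ha' ht' =>
      obtain ⟨rfl, hq, ht'⟩ := ht'
      simp at hq
    | keep hv' ha' ht' =>
      obtain ⟨rfl, rfl, -, rfl⟩ := ht'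
      subst e
      simp only [Head.attach] at hv'
      rw [List.append_cancel_right hv']
      exact ⟨rfl, rfl⟩

/-- The configurations from which `taPDA a b` accepts, for stores of the form that occurs. -/
def TaGood (a b : α) : (taPDA a b).Config → Prop
  | (.init, w, _) => w ∈ langTa a b
  | (.opp, w, s) => ∀ k t, s = List.replicate k false ++ true :: t →
      ∃ j, w = List.replicate j a ++ List.replicate (k + 1 + j) b ++ List.replicate (j + 1) a
  | (.back, w, s) => ∀ k t, s = List.replicate k false ++ true :: t →
      ∃ j, w = List.replicate j a ++ List.replicate (k + 1 + j) b ++ List.replicate j a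
  | (.drop, w, s) => ∀ k t, s = List.replicate k false ++ true :: t →
      w = List.replicate (k + 1) b
  | (.done, w, _) => w = []

/-- Soundness is proved backwards from acceptance. The store shape is a hypothesis inside `TaGood`,
so no invariant of reachable stores is needed. Since the first push writes `true`, `k` symbols
`false` above it stand for `k + 1` pushed letters. -/
theorem taGood_of_step {a b : α} {h : Head} {c c' : (taPDA a b).Config}
    (H : (taPDA a b).Step h c c') (H' : TaGood a b c') : TaGood a b c := by
  cases H with
  | push hv ha ht =>
    obtain ⟨rfl, ht⟩ := ht
    obtain rfl := eq_of_pushPop_eq_push ha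
    subst hv
    rcases ht with ⟨rfl, hp⟩ | ⟨rfl, hp⟩ <;> cases hp
    · obtain ⟨j, rfl⟩ := H' 0 _ rfl
      exact ⟨j + 1, by omega, by simp [Head.attach, List.replicate_succ, Nat.add_comm]⟩
    · rintro k t rfl
      obtain ⟨j, rfl⟩ := H' (k + 1) t rfl
      refine ⟨j + 1, ?_⟩
      rw [show k + 1 + (j + 1) = k + 1 + 1 + j by omega, List.replicate_succ (n := j)]
      simp [Head.attach]
  | @pop q q' x v w s hv ha ht =>
    obtain ⟨rfl, hq, ht⟩ := ht
    obtain rfl := eq_of_pushPop_eq_pop ha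
    subst hv
    have key : ∀ k t, s = List.replicate k false ++ true :: t →
        x :: w = List.replicate (k + 1) x := by
      rintro k t rfl
      rcases ht with ⟨ht, rfl⟩ | ⟨ht, rfl⟩
      · cases k with
        | zero =>
          obtain rfl : w = [] := H'
          rfl
        | succ k => cases ht
      · cases k with
        | zero => cases ht
        | succ k =>
          obtain rfl := H' k t rfl
          rfl
    rcases hq with rfl | rfl
    · intro k t hs
      exact ⟨0, by simpa [Head.attach] using key k t hs⟩
    · exact key
  | keep hv ha ht =>
    obtain ⟨rfl, rfl, rfl, rfl⟩ := ht
    subst hv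
    intro k t hs
    obtain ⟨j, rfl⟩ := H' k t hs
    exact ⟨j, by simp [Head.attach, List.replicate_succ' (n := j)]⟩

theorem taPDA_acceptsFrom_drop {a b : α} (hab : a ≠ b) {q : TaState}
    (hq : q = .back ∨ q = .drop) (k : ℕ) (t : List Bool) :
    (taPDA a b).AcceptsFrom (q, List.replicate (k + 1) b, List.replicate k false ++ true :: t) := by
  induction k generalizing q with
  | zero =>
    refine .of_step (h := .left) (.pop (q' := TaState.done) (a := b) rfl (pushPop_right hab) ?_)
      (.of_mem rfl)
    exact ⟨rfl, hq, Or.inl ⟨rfl, rfl⟩⟩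
  | succ k ih =>
    refine .of_step (h := .left) (.pop (q' := TaState.drop) (a := b) rfl (pushPop_right hab) ?_)
      (ih (Or.inr rfl))
    exact ⟨rfl, hq, Or.inr ⟨rfl, rfl⟩⟩

theorem taPDA_acceptsFrom_back {a b : α} (hab : a ≠ b) (j k : ℕ) (t : List Bool) :
    (taPDA a b).AcceptsFrom (TaState.back,
      List.replicate j a ++ List.replicate (k + 1 + j) b ++ List.replicate j a,
      List.replicate k false ++ true :: t) := by
  induction j generalizing k with
  | zero => simpa using taPDA_acceptsFrom_drop hab (Or.inl rfl) k t
  | succ j ih =>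
    refine .of_step (h := .left) (.push (q' := TaState.opp) (z := false) (a := a)
      (w := List.replicate j a ++ List.replicate (k + 1 + (j + 1)) b ++ List.replicate (j + 1) a)
      rfl (pushPop_left a b) ⟨rfl, Or.inr ⟨rfl, rfl⟩⟩) ?_
    refine .of_step (h := .right) (.keep (q' := TaState.back) (a := a)
      (w := List.replicate j a ++ List.replicate (k + 1 + (j + 1)) b ++ List.replicate j a)
      ?_ rfl ⟨rfl, rfl, rfl, rfl⟩) ?_
    · simp [Head.attach, List.replicate_succ' (n := j)]
    · rw [show k + 1 + (j + 1) = k + 1 + 1 + j by omega]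
      exact ih (k + 1)

theorem taPDA_language {a b : α} (hab : a ≠ b) : (taPDA a b).language = langTa a b := by
  ext w
  constructor
  · intro H
    have H : (taPDA a b).AcceptsFrom ((taPDA a b).start, w, []) := H
    have := AcceptsFrom.induction (P := TaGood a b) (by rintro q rfl s; exact rfl)
      (fun h c c' h1 h2 => taGood_of_step h1 h2) H
    exact this
  · rintro ⟨n, hn, rfl⟩
    obtain ⟨j, rfl⟩ := Nat.exists_eq_add_of_le' hn
    change (taPDA a b).AcceptsFrom (TaState.init, _, [])
    refine .of_step (h := .left) (.push (q' := TaState.opp) (z := true) (a := a)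
      (w := List.replicate j a ++ List.replicate (j + 1) b ++ List.replicate (j + 1) a)
      rfl (pushPop_left a b) ⟨rfl, Or.inl ⟨rfl, rfl⟩⟩) ?_
    refine .of_step (h := .right) (.keep (q' := TaState.back) (a := a)
      (w := List.replicate j a ++ List.replicate (j + 1) b ++ List.replicate j a)
      ?_ rfl ⟨rfl, rfl, rfl, rfl⟩) ?_
    · simp [Head.attach, List.replicate_succ' (n := j)]
    · have := taPDA_acceptsFrom_back hab j 0 []
      rw [show 0 + 1 + j = j + 1 by omega] at this
      exact this

theorem langTa_mem_detDoubleFamily {a b : α} (hab : a ≠ b) : langTa a b ∈ DetDoubleFamily α :=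
  ⟨taPDA a b, taPDA_deterministic a b, taPDA_language hab⟩

end DoubleHeadPDA

/-! ### A nondeterministic automaton with one signature for `langDta` -/

/-- The word as head `h` sees it: reversed for the right head. -/
def Head.orient {α : Type} : Head → List α → List α
  | Head.left, w => w
  | Head.right, w => w.reverse

theorem Head.attach_orient {α : Type} (h : Head) (x : α) (w : List α) :
    h.attach x (h.orient w) = h.orient (x :: w) := by
  cases h <;> simp [Head.attach, Head.orient]

theorem Head.opp_attach_orient {α : Type} (h : Head) (x : α) (w : List α) :
    h.opp.attach x (h.orient w) = h.orient (w ++ [x]) := by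
  cases h <;> simp [Head.attach, Head.orient, Head.opp]

theorem Head.orient_nil {α : Type} (h : Head) : h.orient ([] : List α) = [] := by
  cases h <;> rfl

namespace DoubleHeadPDA

variable {α : Type}

/-- The phases of the automaton for `langDta`. -/
inductive DtaPhase where
  | scanA
  | scanB
  | scanC
  | ready
  | opp
  | back
  | drop
  | done

theorem finite_dtaPhase : Finite DtaPhase :=
  Finite.of_injective
    (fun | .scanA => (0 : Fin 8) | .scanB => 1 | .scanC => 2 | .ready => 3 | .opp => 4
         | .back => 5 | .drop => 6 | .done => 7)
    (by intro x y; cases x <;> cases y <;> simp)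

/-- The state `q` scans `a` for the head `g`, or is the initial state. -/
def Near (q : Option (Head × DtaPhase)) (g : Head) : Prop :=
  q = some (g, .scanA) ∨ q = none

/-- The automaton guesses the head `g` that has the marker behind equal blocks. The other head
reads everything up to the marker. Then head `g` pushes `a` and the other head keeps `c`,
alternately, and finally head `g` pops with `b` what was pushed since the marker. -/
noncomputable def dtaPDA (a b c l r : α) : DoubleHeadPDA α where
  State := Option (Head × DtaPhase)
  Stack := Bool
  finite_state := by
    have := finite_head
    have := finite_dtaPhase
    infer_instance
  finite_stack := inferInstance
  signature _ x := pushPop a b x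
  start := none
  accept := {q | ∃ g, q = some (g, .ready) ∨ q = some (g, .done)}
  deltaD q h _ _ := {p | ∃ g,
    (Near q g ∧ h = g.opp ∧ p = (some (g, .scanA), false)) ∨
    -- The symbol `true` separates the counter from whatever the scan has left in the store.
    (q = some (g, .ready) ∧ h = g ∧ p = (some (g, .opp), true)) ∨
    (q = some (g, .back) ∧ h = g ∧ p = (some (g, .opp), false))}
  deltaR q h _ z := {p | ∃ g,
    ((Near q g ∨ q = some (g, .scanB)) ∧ h = g.opp ∧ p = some (g, .scanB)) ∨
    ((q = some (g, .back) ∨ q = some (g, .drop)) ∧ h = g ∧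
      ((z = some true ∧ p = some (g, .done)) ∨ (z = some false ∧ p = some (g, .drop))))}
  deltaN q h x _ := {p | ∃ g, h = g.opp ∧
    (((Near q g ∨ q = some (g, .scanB) ∨ q = some (g, .scanC)) ∧
      ((x = c ∧ p = some (g, .scanC)) ∨ (x = g.marker l r ∧ p = some (g, .ready)))) ∨
    (q = some (g, .opp) ∧ x = c ∧ p = some (g, .back)))}

/-- The words, seen from head `g`, from which `dtaPDA` accepts in a given phase, for stores of the
form that occurs. -/
def DtaPhaseGood (a b c m : α) (w : List α) (s : List Bool) : DtaPhase → Prop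
  | .scanA => ∃ n i j k, w =
      List.replicate n a ++ List.replicate n b ++ List.replicate n c ++ [m] ++
        List.replicate i c ++ List.replicate j b ++ List.replicate k a
  | .scanB => ∃ n i j, w =
      List.replicate n a ++ List.replicate n b ++ List.replicate n c ++ [m] ++
        List.replicate i c ++ List.replicate j b
  | .scanC => ∃ n i, w =
      List.replicate n a ++ List.replicate n b ++ List.replicate n c ++ [m] ++
        List.replicate i c
  | .ready => ∃ n, w = List.replicate n a ++ List.replicate n b ++ List.replicate n c
  | .opp => ∀ k t, s = List.replicate k false ++ true :: t → ∃ j, w =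
      List.replicate j a ++ List.replicate (k + 1 + j) b ++ List.replicate (j + 1) c
  | .back => ∀ k t, s = List.replicate k false ++ true :: t → ∃ j, w =
      List.replicate j a ++ List.replicate (k + 1 + j) b ++ List.replicate j c
  | .drop => ∀ k t, s = List.replicate k false ++ true :: t → w = List.replicate (k + 1) b
  | .done => w = []

/-- The scan skips a phase when the corresponding block is empty. -/
theorem DtaPhaseGood.scanB_of_scanC {a b c m : α} {w : List α} {s : List Bool}
    (H : DtaPhaseGood a b c m w s .scanC) :
    DtaPhaseGood a b c m w s .scanB := by
  obtain ⟨n, i, rfl⟩ := H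
  exact ⟨n, i, 0, by simp⟩

theorem DtaPhaseGood.scanA_of_scanB {a b c m : α} {w : List α} {s : List Bool}
    (H : DtaPhaseGood a b c m w s .scanB) :
    DtaPhaseGood a b c m w s .scanA := by
  obtain ⟨n, i, j, rfl⟩ := H
  exact ⟨n, i, j, 0, by simp⟩

/-- The configurations from which `dtaPDA a b c l r` accepts, for stores of the form that
occurs. -/
def DtaGood (a b c l r : α) (x : (dtaPDA a b c l r).Config) : Prop :=
  ∃ g p w, (x.1 = some (g, p) ∨ (x.1 = none ∧ p = .scanA)) ∧ x.2.1 = g.orient w ∧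
    DtaPhaseGood a b c (g.marker l r) w x.2.2 p

theorem DtaGood.exists_of_some {a b c l r : α} {g : Head} {p : DtaPhase} {w : List α}
    {s : List Bool} (H : DtaGood a b c l r (some (g, p), w, s)) :
    ∃ w', w = g.orient w' ∧ DtaPhaseGood a b c (g.marker l r) w' s p := by
  obtain ⟨g', p', w', h1, h2, h3⟩ := H
  rcases h1 with h1 | ⟨h1, -⟩
  · cases h1
    exact ⟨w', h2, h3⟩
  · cases h1

theorem DtaGood.of_near {a b c l r : α} {q : Option (Head × DtaPhase)} {g : Head} {w : List α}
    {s : List Bool} (hq : Near q g) (H : DtaPhaseGood a b c (g.marker l r) w s .scanA) :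
    DtaGood a b c l r (q, g.orient w, s) := by
  refine ⟨g, .scanA, w, ?_, rfl, H⟩
  rcases hq with rfl | rfl
  · exact Or.inl rfl
  · exact Or.inr ⟨rfl, rfl⟩

theorem DtaGood.of_some {a b c l r : α} {g : Head} {p : DtaPhase} {w : List α}
    {s : List Bool} (H : DtaPhaseGood a b c (g.marker l r) w s p) :
    DtaGood a b c l r (some (g, p), g.orient w, s) :=
  ⟨g, p, w, Or.inl rfl, rfl, H⟩

theorem DtaGood.of_scan {a b c l r : α} {q : Option (Head × DtaPhase)} {g : Head} {w : List α}
    {s : List Bool} (hq : Near q g ∨ q = some (g, .scanB) ∨ q = some (g, .scanC))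
    (H : DtaPhaseGood a b c (g.marker l r) w s .scanC) :
    DtaGood a b c l r (q, g.orient w, s) := by
  rcases hq with hq | rfl | rfl
  · exact .of_near hq H.scanB_of_scanC.scanA_of_scanB
  · exact .of_some H.scanB_of_scanC
  · exact .of_some H

/-- Again goodness is pulled back from acceptance. The initial state acts as `scanA` for either
head, which is why `DtaGood` quantifies over `g`. -/
theorem dtaGood_of_step {a b c l r : α} {h : Head} {x x' : (dtaPDA a b c l r).Config}
    (H : (dtaPDA a b c l r).Step h x x') (H' : DtaGood a b c l r x') : DtaGood a b c l r x := by
  cases H with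
  | push hv ha ht =>
    obtain rfl := eq_of_pushPop_eq_push ha
    subst hv
    obtain ⟨g, ht⟩ := ht
    rcases ht with ⟨hq, rfl, hp⟩ | ⟨rfl, rfl, hp⟩ | ⟨rfl, rfl, hp⟩ <;> cases hp
    · obtain ⟨w, rfl, n, i, j, k, rfl⟩ := H'.exists_of_some
      rw [Head.opp_attach_orient]
      exact .of_near hq ⟨n, i, j, k + 1, by simp [List.replicate_succ' (n := k)]⟩
    · obtain ⟨w, rfl, hw⟩ := H'.exists_of_some
      obtain ⟨j, rfl⟩ := hw 0 _ rfl
      rw [Head.attach_orient]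
      exact .of_some ⟨j + 1, by simp [List.replicate_succ, Nat.add_comm]⟩
    · obtain ⟨w, rfl, hw⟩ := H'.exists_of_some
      rw [Head.attach_orient]
      refine .of_some ?_
      rintro k t rfl
      obtain ⟨j, rfl⟩ := hw (k + 1) t rfl
      refine ⟨j + 1, ?_⟩
      rw [show k + 1 + (j + 1) = k + 1 + 1 + j by omega]
      simp [List.replicate_succ (n := j)]
  | @pop q q' x v w s hv ha ht =>
    obtain rfl := eq_of_pushPop_eq_pop ha
    subst hv
    obtain ⟨g, ⟨hq, rfl, rfl⟩ | ⟨hq, rfl, ht⟩⟩ := ht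
    · obtain ⟨w, rfl, n, i, j, rfl⟩ := H'.exists_of_some
      rw [Head.opp_attach_orient]
      have hw : ∀ s, DtaPhaseGood a x c (g.marker l r) (_ ++ [x]) s .scanB :=
        fun s => ⟨n, i, j + 1, by
          rw [List.replicate_succ' (n := j), ← List.append_assoc]⟩
      rcases hq with hq | rfl
      · exact .of_near hq (hw _).scanA_of_scanB
      · exact .of_some (hw _)
    · have key : ∃ w', h.attach x w = h.orient w' ∧
          ∀ k t, s = List.replicate k false ++ true :: t → w' = List.replicate (k + 1) x := by
        rcases ht with ⟨ht, rfl⟩ | ⟨ht, rfl⟩ <;>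
          obtain ⟨w, rfl, hw⟩ := H'.exists_of_some <;>
          refine ⟨_, Head.attach_orient _ _ _, ?_⟩ <;>
          rintro k t rfl
        · cases k with
          | zero =>
            obtain rfl : w = [] := hw
            rfl
          | succ k => cases ht
        · cases k with
          | zero => cases ht
          | succ k =>
            obtain rfl := hw k t rfl
            rfl
      obtain ⟨w, h1, h2⟩ := key
      rw [h1]
      rcases hq with rfl | rfl
      · exact .of_some fun k t hs => ⟨0, by simpa using h2 k t hs⟩
      · exact .of_some h2
  | keep hv ha ht =>
    subst hv
    obtain ⟨g, rfl, ⟨hq, ⟨rfl, rfl⟩ | ⟨rfl, rfl⟩⟩ | ⟨rfl, rfl, rfl⟩⟩ := ht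
    · obtain ⟨w, rfl, n, i, rfl⟩ := H'.exists_of_some
      rw [Head.opp_attach_orient]
      exact .of_scan hq ⟨n, i + 1, by rw [List.replicate_succ' (n := i), ← List.append_assoc]⟩
    · obtain ⟨w, rfl, n, rfl⟩ := H'.exists_of_some
      rw [Head.opp_attach_orient]
      exact .of_scan hq ⟨n, 0, by simp⟩
    · obtain ⟨w, rfl, hw⟩ := H'.exists_of_some
      rw [Head.opp_attach_orient]
      refine .of_some ?_
      rintro k t rfl
      obtain ⟨j, rfl⟩ := hw k t rfl
      exact ⟨j, by simp [List.replicate_succ' (n := j)]⟩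

theorem dtaPDA_acceptsFrom_drop {a b : α} (hab : a ≠ b) (c l r : α) {g : Head}
    {q : Option (Head × DtaPhase)} (hq : q = some (g, .back) ∨ q = some (g, .drop)) (k : ℕ)
    (t : List Bool) :
    (dtaPDA a b c l r).AcceptsFrom
      (q, g.orient (List.replicate (k + 1) b), List.replicate k false ++ true :: t) := by
  induction k generalizing q with
  | zero =>
    refine .of_step (h := g) (.pop (q' := some (g, DtaPhase.done)) (a := b) (w := [])
      ?_ (pushPop_right hab) ⟨g, Or.inr ⟨hq, rfl, Or.inl ⟨rfl, rfl⟩⟩⟩)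
      (.of_mem ⟨g, Or.inr rfl⟩)
    cases g <;> rfl
  | succ k ih =>
    refine .of_step (h := g) (.pop (q' := some (g, DtaPhase.drop)) (a := b)
      (w := g.orient (List.replicate (k + 1) b)) ?_ (pushPop_right hab)
      ⟨g, Or.inr ⟨hq, rfl, Or.inr ⟨rfl, rfl⟩⟩⟩) (ih (Or.inr rfl))
    rw [Head.attach_orient]
    rfl

theorem dtaPDA_acceptsFrom_back {a b c : α} (hab : a ≠ b) (hac : a ≠ c) (hbc : b ≠ c) (l r : α)
    (g : Head) (j k : ℕ) (t : List Bool) :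
    (dtaPDA a b c l r).AcceptsFrom (some (g, DtaPhase.back),
      g.orient (List.replicate j a ++ List.replicate (k + 1 + j) b ++ List.replicate j c),
      List.replicate k false ++ true :: t) := by
  induction j generalizing k with
  | zero => simpa using dtaPDA_acceptsFrom_drop hab c l r (Or.inl rfl) k t
  | succ j ih =>
    refine .of_step (h := g) (.push (q' := some (g, DtaPhase.opp)) (z := false) (a := a)
      (w := g.orient
        (List.replicate j a ++ List.replicate (k + 1 + (j + 1)) b ++ List.replicate (j + 1) c))
      ?_ (pushPop_left a b) ⟨g, Or.inr (Or.inr ⟨rfl, rfl, rfl⟩)⟩) ?_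
    · rw [Head.attach_orient]
      rfl
    refine .of_step (h := g.opp) (.keep (q' := some (g, DtaPhase.back)) (a := c)
      (w := g.orient
        (List.replicate j a ++ List.replicate (k + 1 + (j + 1)) b ++ List.replicate j c))
      ?_ (pushPop_of_ne hac.symm hbc.symm) ⟨g, rfl, Or.inr ⟨rfl, rfl, rfl⟩⟩) ?_
    · rw [Head.opp_attach_orient, List.replicate_succ' (n := j), ← List.append_assoc]
    · rw [show k + 1 + (j + 1) = k + 1 + 1 + j by omega]
      exact ih (k + 1)

/-- For `n = 0` nothing is left to read, which is why `ready` accepts. The store `s` is arbitrary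
because it is the residue of the scan. -/
theorem dtaPDA_acceptsFrom_ready {a b c : α} (hab : a ≠ b) (hac : a ≠ c) (hbc : b ≠ c) (l r : α)
    (g : Head) (n : ℕ) (s : List Bool) :
    (dtaPDA a b c l r).AcceptsFrom (some (g, DtaPhase.ready),
      g.orient (List.replicate n a ++ List.replicate n b ++ List.replicate n c), s) := by
  cases n with
  | zero =>
    have : g.orient (List.replicate 0 a ++ List.replicate 0 b ++ List.replicate 0 c) = [] :=
      g.orient_nil
    rw [this]
    exact .of_mem ⟨g, Or.inl rfl⟩
  | succ j =>
    refine .of_step (h := g) (.push (q' := some (g, DtaPhase.opp)) (z := true) (a := a)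
      (w := g.orient
        (List.replicate j a ++ List.replicate (j + 1) b ++ List.replicate (j + 1) c))
      ?_ (pushPop_left a b) ⟨g, Or.inr (Or.inl ⟨rfl, rfl, rfl⟩)⟩) ?_
    · rw [Head.attach_orient]
      rfl
    refine .of_step (h := g.opp) (.keep (q' := some (g, DtaPhase.back)) (a := c)
      (w := g.orient (List.replicate j a ++ List.replicate (j + 1) b ++ List.replicate j c))
      ?_ (pushPop_of_ne hac.symm hbc.symm) ⟨g, rfl, Or.inr ⟨rfl, rfl, rfl⟩⟩) ?_
    · rw [Head.opp_attach_orient, List.replicate_succ' (n := j) (a := c), ← List.append_assoc]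
    · have := dtaPDA_acceptsFrom_back hab hac hbc l r g j 0 s
      rw [show 0 + 1 + j = j + 1 by omega] at this
      exact this

section Scan

variable {a b c l r : α} {g : Head}

theorem dtaPDA_acceptsFrom_scanC (hab : a ≠ b) (hac : a ≠ c) (hbc : b ≠ c)
    (ha : g.marker l r ≠ a) (hb : g.marker l r ≠ b) (n i : ℕ) (s : List Bool)
    {q : Option (Head × DtaPhase)}
    (hq : Near q g ∨ q = some (g, .scanB) ∨ q = some (g, .scanC)) :
    (dtaPDA a b c l r).AcceptsFrom (q, g.orient
      (List.replicate n a ++ List.replicate n b ++ List.replicate n c ++ [g.marker l r] ++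
        List.replicate i c), s) := by
  induction i generalizing q with
  | zero =>
    refine .of_step (h := g.opp) (.keep (q' := some (g, DtaPhase.ready)) (a := g.marker l r)
      (w := g.orient (List.replicate n a ++ List.replicate n b ++ List.replicate n c))
      ?_ (pushPop_of_ne ha hb) ⟨g, rfl, Or.inl ⟨hq, Or.inr ⟨rfl, rfl⟩⟩⟩)
      (dtaPDA_acceptsFrom_ready hab hac hbc l r g n s)
    rw [Head.opp_attach_orient]
    simp
  | succ i ih =>
    refine .of_step (h := g.opp) (.keep (q' := some (g, DtaPhase.scanC)) (a := c)
      ?_ (pushPop_of_ne hac.symm hbc.symm) ⟨g, rfl, Or.inl ⟨hq, Or.inl ⟨rfl, rfl⟩⟩⟩)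
      (ih (Or.inr (Or.inr rfl)))
    rw [Head.opp_attach_orient, List.replicate_succ' (n := i), ← List.append_assoc]

theorem dtaPDA_acceptsFrom_scanB (hab : a ≠ b) (hac : a ≠ c) (hbc : b ≠ c)
    (ha : g.marker l r ≠ a) (hb : g.marker l r ≠ b) (n i j : ℕ) (s : List Bool)
    {q : Option (Head × DtaPhase)} (hq : Near q g ∨ q = some (g, .scanB)) :
    (dtaPDA a b c l r).AcceptsFrom (q, g.orient
      (List.replicate n a ++ List.replicate n b ++ List.replicate n c ++ [g.marker l r] ++
        List.replicate i c ++ List.replicate j b), s) := by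
  -- The scan changes the store without depending on it, so `s` has to vary.
  induction j generalizing q s with
  | zero =>
    rw [List.replicate_zero, List.append_nil]
    exact dtaPDA_acceptsFrom_scanC hab hac hbc ha hb n i s (by tauto)
  | succ j ih =>
    refine .of_step (h := g.opp) (.pop (q' := some (g, DtaPhase.scanB)) (a := b)
      ?_ (pushPop_right hab) ⟨g, Or.inl ⟨hq, rfl, rfl⟩⟩) (ih _ (Or.inr rfl))
    rw [Head.opp_attach_orient, List.replicate_succ' (n := j), ← List.append_assoc]

theorem dtaPDA_acceptsFrom_scanA (hab : a ≠ b) (hac : a ≠ c) (hbc : b ≠ c)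
    (ha : g.marker l r ≠ a) (hb : g.marker l r ≠ b) (n i j k : ℕ) (s : List Bool)
    {q : Option (Head × DtaPhase)} (hq : Near q g) :
    (dtaPDA a b c l r).AcceptsFrom (q, g.orient
      (List.replicate n a ++ List.replicate n b ++ List.replicate n c ++ [g.marker l r] ++
        List.replicate i c ++ List.replicate j b ++ List.replicate k a), s) := by
  induction k generalizing q s with
  | zero =>
    rw [List.replicate_zero, List.append_nil]
    exact dtaPDA_acceptsFrom_scanB hab hac hbc ha hb n i j s (Or.inl hq)
  | succ k ih =>
    refine .of_step (h := g.opp) (.push (q' := some (g, DtaPhase.scanA)) (z := false) (a := a)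
      ?_ (pushPop_left a b) ⟨g, Or.inl ⟨hq, rfl, rfl⟩⟩) (ih _ (Or.inl rfl))
    rw [Head.opp_attach_orient, List.replicate_succ' (n := k), ← List.append_assoc]

end Scan

theorem dtaPDA_language {a b c l r : α} (hd : [a, b, c, l, r].Nodup) :
    (dtaPDA a b c l r).language = langDta a b c l r := by
  simp only [List.nodup_cons, List.mem_cons, List.not_mem_nil, or_false, not_or] at hd
  obtain ⟨⟨hab, hac, hal, har⟩, ⟨hbc, hbl, hbr⟩, -⟩ := hd
  ext w
  constructor
  · intro H
    have H : (dtaPDA a b c l r).AcceptsFrom ((dtaPDA a b c l r).start, w, []) := H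
    obtain ⟨g, p, w', h1, h2, h3⟩ := AcceptsFrom.induction (P := DtaGood a b c l r) (by
      rintro q ⟨g, rfl | rfl⟩ s
      · exact ⟨g, .ready, [], Or.inl rfl, g.orient_nil.symm, 0, rfl⟩
      · exact ⟨g, .done, [], Or.inl rfl, g.orient_nil.symm, rfl⟩)
      (fun h c c' h1 h2 => dtaGood_of_step h1 h2) H
    rcases h1 with h1 | ⟨-, rfl⟩
    · cases h1
    obtain ⟨n, i, j, k, rfl⟩ := h3
    simp only at h2
    subst h2
    cases g
    · exact Or.inl ⟨i, j, k, n, rfl⟩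
    · exact Or.inr ⟨k, j, i, n, by simp [Head.orient, Head.marker]⟩
  · have key : ∀ g : Head, g.marker l r ≠ a ∧ g.marker l r ≠ b := by
      rintro (_ | _)
      · exact ⟨Ne.symm hal, Ne.symm hbl⟩
      · exact ⟨Ne.symm har, Ne.symm hbr⟩
    rintro (⟨i, j, k, n, rfl⟩ | ⟨i, j, k, n, rfl⟩)
    · exact dtaPDA_acceptsFrom_scanA (g := .left) hab hac hbc (key _).1 (key _).2 n i j k []
        (Or.inr rfl)
    · have h1 := dtaPDA_acceptsFrom_scanA (l := l) (r := r) (g := .right) hab hac hbc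
        (key _).1 (key _).2 n k j i [] (Or.inr rfl)
      have h2 : Head.right.orient
          (List.replicate n a ++ List.replicate n b ++ List.replicate n c ++
            [Head.right.marker l r] ++ List.replicate k c ++ List.replicate j b ++
            List.replicate i a) =
          List.replicate i a ++ List.replicate j b ++ List.replicate k c ++ [r] ++
            List.replicate n c ++ List.replicate n b ++ List.replicate n a := by
        simp [Head.orient, Head.marker]
      rw [h2] at h1
      exact h1

theorem langDta_mem_nondetSingleFamily {a b c l r : α} (hd : [a, b, c, l, r].Nodup) :
    langDta a b c l r ∈ NondetSingleFamily α :=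
  ⟨dtaPDA a b c l r, rfl, dtaPDA_language hd⟩

end DoubleHeadPDA

theorem mainTheorem3 :
    ((¬ ∀ (α : Type) [Finite α], DetDoubleFamily α ⊆ NondetSingleFamily α) ∧
      (¬ ∀ (α : Type) [Finite α], NondetSingleFamily α ⊆ DetDoubleFamily α)) ∧
    (∀ (α : Type) [Finite α] (a b : α), a ≠ b →
      langTa a b ∈ DetDoubleFamily α ∧ langTa a b ∉ NondetSingleFamily α) ∧
    (∀ (α : Type) [Finite α] (a b c l r : α), [a, b, c, l, r].Nodup →
      langDta a b c l r ∈ NondetSingleFamily α ∧ langDta a b c l r ∉ DetDoubleFamily α) := by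
  refine ⟨⟨fun H => ?_, fun H => ?_⟩, fun α _ a b hab => ?_, fun α _ a b c l r hd => ?_⟩
  · have hab : false ≠ true := by decide
    exact DoubleHeadPDA.langTa_notMem_nondetSingleFamily hab
      (H Bool (DoubleHeadPDA.langTa_mem_detDoubleFamily hab))
  · have hd : [(0 : Fin 5), 1, 2, 3, 4].Nodup := by decide
    exact DoubleHeadPDA.langDta_notMem_detDoubleFamily hd
      (H (Fin 5) (DoubleHeadPDA.langDta_mem_nondetSingleFamily hd))
  · exact ⟨DoubleHeadPDA.langTa_mem_detDoubleFamily hab,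
      DoubleHeadPDA.langTa_notMem_nondetSingleFamily hab⟩
  · exact ⟨DoubleHeadPDA.langDta_mem_nondetSingleFamily hd,
      DoubleHeadPDA.langDta_notMem_detDoubleFamily hd⟩
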